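/- **Theorem 2 (SCG convergence).** Let $\mathcal G$ be a connected undirected simple graph on the agents $\{1,\dots,n\}$, $n\ge 1$, let $d_i$ be the degree of $i$, and let $W$ be its Metropolis–Hastings matrix: $W_{ij}=1/(1+\max\{d_i,d_j\})$ if $i,j$ are adjacent, $W_{ij}=0$ if $i\ne j$ are not adjacent, and $W_{ii}=1-\sum_{j\ne i}W_{ij}$. Let $\gamma\in(0,\tfrac12]$ and $$\sigma=\frac{5n-\sqrt\gamma}{5n+\sqrt\gamma},\quad \lambda=1-\frac{\sqrt\gamma}{5n},\quad \tilde\lambda=1-\frac{\sqrt\gamma}{10n},\quad \kappa_2=\sqrt{2\sigma^2+2\sigma+1},\quad \kappa_3=\sqrt{2\sigma^2+2},\quad \beta=\|W-I\|,$$ with $\|\cdot\|$ the spectral norm. Let $\omega\in[0,1)$ and let $Q(x)=Q(x,\zeta)$ be a (possibly biased) random compressor on $\mathbb R^d$ with $\mathbb E_\zeta\|Q(x,\zeta)-x\|^2\le\omega^2\|x\|^2$ for all $x\in\mathbb R^d$. Scalable Compressed Gossip starts from a deterministic $X(0)\in\mathbb R^{n\times d}$ with $Y(0)=X(0)$, $\hat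 X(0)=0$ and iterates $$\hat X(t+1)=\hat X(t)+Q\big(X(t)-\hat X(t)\big),\qquad Y(t+1)=X(t)+\gamma(W-I)\hat X(t+1),\qquad X(t+1)=(1+\sigma)Y(t+1)-\sigma Y(t),$$ where $Q$ acts on each row, with randomness that has the law of $\zeta$ for each row and is independent between rounds. Let $\overline X$ be the matrix all of whose rows equal the average of the rows of $X(0)$, and $\Psi(t)=\|X(t)-\overline X\|_F$. There are absolute constants $C,K,c_1,c_2>0$ such that the following holds. The threshold $$\omega^\ast=\Big(2(\kappa_3+\gamma\beta\kappa_2)\big(\lambda^{-1/2}+\gamma\beta\kappa_2C\,\lambda^{-1}(1-\lambda^{1/2})^{-2}\big)\Big)^{-1}$$ satisfies $\dfrac{c_1}{(1+\gamma)n^2}\le\omega^\ast\le\dfrac{c_2}{(1+\gamma)n^2}$, and if $\omega\le\omega^\ast$, then for all $t\ge 0$ the variable $\Psi(t)$ is integrable and $$\mathbb E\,\Psi(t)\le K\,\tilde\lambda^{\,t}\,\|X(0)\|_F .$$ In particular, if $X(0)\ne\overline X$, then $$\mathbb E\,\Psi(t)\le C_0\,\tilde\lambda^{\,t}\,\Psi(0)\qquad\text{for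 all } t\ge 0,$$ with a constant $C_0>0$ that depends on $X(0)$ only. -/

import Mathlib

open MeasureTheory ProbabilityTheory

namespace SCG

noncomputable section

/-- The vector held by one agent: an element of `ℝ^d` with the Euclidean norm. -/
abbrev Vec (d : ℕ) : Type := EuclideanSpace ℝ (Fin d)

/-- An `n × d` real matrix, given by its `n` rows. -/
abbrev Rows (n d : ℕ) : Type := Fin n → Vec d

/-- The Frobenius norm of the `n × d` matrix with rows `X i`. -/
def frob {n d : ℕ} (X : Rows n d) : ℝ := Real.sqrt (∑ i, ‖X i‖ ^ 2)

/-- The matrix all of whose rows are the average of the rows of `X`. -/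
def avg {n d : ℕ} (X : Rows n d) : Rows n d := fun _ => (n : ℝ)⁻¹ • ∑ j, X j

/-- The matrix product of an `n × n` matrix and an `n × d` matrix given by rows. -/
def act {n d : ℕ} (A : Matrix (Fin n) (Fin n) ℝ) (X : Rows n d) : Rows n d :=
  fun i => ∑ j, A i j • X j

/-- Off-diagonal entries of the Metropolis-Hastings matrix; the closed neighbourhood of `i`
has `G.degree i + 1` elements. -/
def mhOff {n : ℕ} (G : SimpleGraph (Fin n)) [DecidableRel G.Adj] (i j : Fin n) : ℝ :=
  if G.Adj i j then 1 / (max (G.degree i + 1) (G.degree j + 1) : ℕ) else 0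

/-- The Metropolis-Hastings mixing matrix of a graph. -/
def metropolis {n : ℕ} (G : SimpleGraph (Fin n)) [DecidableRel G.Adj] :
    Matrix (Fin n) (Fin n) ℝ :=
  Matrix.of fun i j =>
    if i = j then 1 - ∑ k ∈ Finset.univ.erase i, mhOff G i k else mhOff G i j

/-- The spectral norm (operator norm for the Euclidean norm) of a square matrix. -/
def specNorm {n : ℕ} (A : Matrix (Fin n) (Fin n) ℝ) : ℝ :=
  ‖Matrix.toEuclideanCLM (n := Fin n) (𝕜 := ℝ) A‖

/-- The momentum `σ = (5n - √γ) / (5n + √γ)`. -/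
def momentum (n : ℕ) (γ : ℝ) : ℝ := (5 * n - Real.sqrt γ) / (5 * n + Real.sqrt γ)

/-- The rate `λ = 1 - √γ / (5n)` of the uncompressed method. -/
def rate (n : ℕ) (γ : ℝ) : ℝ := 1 - Real.sqrt γ / (5 * n)

/-- The rate `1 - √γ / (10n)` of the compressed method. -/
def rateTilde (n : ℕ) (γ : ℝ) : ℝ := 1 - Real.sqrt γ / (10 * n)

def kappa2 (n : ℕ) (γ : ℝ) : ℝ :=
  Real.sqrt (2 * momentum n γ ^ 2 + 2 * momentum n γ + 1)

def kappa3 (n : ℕ) (γ : ℝ) : ℝ := Real.sqrt (2 * momentum n γ ^ 2 + 2)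

/-- The admissible compression level
`(2 (κ₃ + γ β κ₂) (λ^(-1/2) + γ β κ₂ C λ^(-1) (1 - λ^(1/2))^(-2)))⁻¹` with `β = ‖W - I‖`. -/
def threshold {n : ℕ} (W : Matrix (Fin n) (Fin n) ℝ) (γ C : ℝ) : ℝ :=
  (2 * (kappa3 n γ + γ * specNorm (W - 1) * kappa2 n γ) *
    ((Real.sqrt (rate n γ))⁻¹ +
      γ * specNorm (W - 1) * kappa2 n γ * C * (rate n γ)⁻¹ *
        ((1 - Real.sqrt (rate n γ)) ^ 2)⁻¹))⁻¹

/-- `Q` is a (possibly biased) random compressor of level `ω`: `Q x z` is the output on `x` when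
the internal randomness, whose law is `P`, takes the value `z`, and
`E ‖Q x - x‖² ≤ ω² ‖x‖²` for every `x`. -/
structure IsCompressor {d : ℕ} {Z : Type*} [MeasurableSpace Z] (P : Measure Z) (ω : ℝ)
    (Q : Vec d → Z → Vec d) : Prop where
  measurable : Measurable (fun p : Vec d × Z => Q p.1 p.2)
  error_le : ∀ x : Vec d, ∫⁻ z, ENNReal.ofReal (‖Q x z - x‖ ^ 2) ∂P ≤
    ENNReal.ofReal (ω ^ 2 * ‖x‖ ^ 2)

/-- The matrices `X̂(t)`, `Y(t)`, `X(t)` maintained by the algorithm. -/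
structure State (n d : ℕ) where
  xhat : Rows n d
  y : Rows n d
  x : Rows n d

/-- One round, where `z i` is the randomness that the compressor of agent `i` uses in it. -/
def step {n d : ℕ} {Z : Type*} (W : Matrix (Fin n) (Fin n) ℝ) (γ σ : ℝ)
    (Q : Vec d → Z → Vec d) (z : Fin n → Z) (S : State n d) : State n d :=
  let xhat' : Rows n d := fun i => S.xhat i + Q (S.x i - S.xhat i) (z i)
  let y' : Rows n d := S.x + γ • act (W - 1) xhat'
  { xhat := xhat'
    y := y'
    x := (1 + σ) • y' - σ • S.y }

/-- The run of the algorithm from `X(0) = Y(0) = X₀`, `X̂(0) = 0`, where `z t i` is the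
randomness used by the compressor of agent `i` in round `t`. -/
def run {n d : ℕ} {Z : Type*} (W : Matrix (Fin n) (Fin n) ℝ) (γ σ : ℝ)
    (Q : Vec d → Z → Vec d) (X₀ : Rows n d) (z : ℕ → Fin n → Z) : ℕ → State n d
  | 0 => { xhat := 0, y := X₀, x := X₀ }
  | t + 1 => step W γ σ Q (z t) (run W γ σ Q X₀ z t)

/-- `Ψ(t) = ‖X(t) - X̄‖_F`, the distance to consensus on the initial average after `t` rounds of
the algorithm on the graph `G` with Metropolis-Hastings mixing matrix and momentum
`(5n - √γ) / (5n + √γ)`. -/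
def err {n d : ℕ} {Z : Type*} (G : SimpleGraph (Fin n)) [DecidableRel G.Adj] (γ : ℝ)
    (Q : Vec d → Z → Vec d) (X₀ : Rows n d) (z : ℕ → Fin n → Z) (t : ℕ) : ℝ :=
  frob ((run (metropolis G) γ (momentum n γ) Q X₀ z t).x - avg X₀)

end

end SCG

namespace SCG

/-! ### Spectral gap of the Metropolis–Hastings matrix -/

section Graph

/-! Put `q = √γ / (5n)`, so that `σ = (1 - q) / (1 + q)`. In an orthonormal eigenbasis of `1 - W`
the uncompressed method splits into scalar recursions `(x, y) ↦ ((1 + σ) w x - σ y, w x)` with `w =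
1 - δ`, `δ = γ μ`. Along a geodesic the degrees sum to `O(n)`, so every nonconstant eigenvector has
`μ ≥ 1 / (12 n²)` (`exists_modes`), and hence `δ ≥ 2 q²`. This is the oscillating regime: for `δ <
1` the two characteristic roots are complex conjugates of squared modulus `σ w`. A definite
quadratic form, `modeForm`, is therefore multiplied by exactly `σ w` (`modeForm_step`). Summed over
the modes, it gives a norm, `potential`, that contracts by `√σ ≤ 1 - 9q/10` in each round.

Compression replaces `X(t)` by `X(t)` plus a distortion inside the gossip term. It is a forcing
whose potential is at most `2 √γ` times the Frobenius norm of the distortion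
(`norm_potential_step_le`). The distortion of a round uses randomness independent of the past, so
its mean norm is at most `ω` times that of the residual `X - X̂`
(`lintegral_frob_distortion_residual_le`). The residual is in turn bounded by consensus errors and
the previous distortion.

This loop closes at rate `1 - q / 2` once `ω` is below a small multiple of `1 / n`
(`closed_loop_le`). The threshold is of order `1 / n²`, because `γ / (1 - √λ)²` is comparable to `γ
/ q² = 25 n²`; so `ω ≤ ω*` is more than enough (`threshold_le`). For `n = 1` the error vanishes
identically. -/

theorem exists_geodesic {V : Type*} (G : SimpleGraph V) (hG : G.Connected) (i j : V) :
    ∃ (L : ℕ) (u : ℕ → V), u 0 = i ∧ u L = j ∧ (∀ m < L, G.Adj (u m) (u (m + 1))) ∧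
      ∀ m ≤ L, G.dist i (u m) = m := by
  obtain ⟨p, hp⟩ := hG.exists_walk_length_eq_dist i j
  refine ⟨p.length, p.getVert, p.getVert_zero, p.getVert_length,
    fun m hm => p.adj_getVert_succ hm, fun m hm => ?_⟩
  -- Upper bounds for both pieces of a shortest walk, with the triangle inequality, force the first
  -- distance to equal `m`.
  have h1 := SimpleGraph.dist_le (p.take m)
  have h2 := SimpleGraph.dist_le (p.drop m)
  have h3 : G.dist i j ≤ G.dist i (p.getVert m) + G.dist (p.getVert m) j := hG.dist_triangle
  rw [SimpleGraph.Walk.take_length] at h1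
  rw [SimpleGraph.Walk.drop_length] at h2
  omega

variable {n : ℕ} (G : SimpleGraph (Fin n)) [DecidableRel G.Adj]

theorem mhOff_symm (i j : Fin n) : mhOff G i j = mhOff G j i := by
  unfold mhOff
  simp only [G.adj_comm i j, max_comm (G.degree i + 1)]

theorem mhOff_self (i : Fin n) : mhOff G i i = 0 := by
  simp [mhOff]

theorem mhOff_nonneg (i j : Fin n) : 0 ≤ mhOff G i j := by
  unfold mhOff
  split_ifs <;> positivity

theorem sum_mhOff_le_one (i : Fin n) : ∑ j, mhOff G i j ≤ 1 := by
  have h : ∀ j, mhOff G i j ≤ if G.Adj i j then 1 / ((G.degree i : ℝ) + 1) else 0 := by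
    intro j
    unfold mhOff
    split_ifs
    · apply one_div_le_one_div_of_le (by positivity)
      exact_mod_cast le_max_left _ _
    · exact le_rfl
  refine (Finset.sum_le_sum fun j _ => h j).trans ?_
  rw [← Finset.sum_filter, Finset.sum_const, ← SimpleGraph.neighborFinset_eq_filter,
    SimpleGraph.card_neighborFinset_eq_degree, nsmul_eq_mul, mul_one_div]
  exact div_le_one_of_le₀ (by linarith) (by positivity)

theorem metropolis_sub_one_apply (i j : Fin n) :
    (metropolis G - 1) i j = mhOff G i j - if i = j then ∑ k, mhOff G i k else 0 := by
  rw [Matrix.sub_apply, metropolis, Matrix.of_apply, Matrix.one_apply]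
  split_ifs with h
  · subst h
    rw [← Finset.add_sum_erase _ _ (Finset.mem_univ i), mhOff_self]
    ring
  · ring

theorem metropolis_isSymm : (metropolis G).IsSymm := by
  have h : (metropolis G - 1).IsSymm := by
    ext i j
    rw [Matrix.transpose_apply, metropolis_sub_one_apply, metropolis_sub_one_apply, mhOff_symm]
    by_cases h : i = j
    · subst h; rfl
    · simp [h, Ne.symm h]
  simpa using h.add Matrix.isSymm_one

theorem sum_metropolis_sub_one (i : Fin n) : ∑ j, (metropolis G - 1) i j = 0 := by
  simp_rw [metropolis_sub_one_apply, Finset.sum_sub_distrib]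
  simp

theorem metropolis_sub_one_mulVec (v : Fin n → ℝ) (i : Fin n) :
    ((metropolis G - 1).mulVec v) i = ∑ j, mhOff G i j * (v j - v i) := by
  simp_rw [Matrix.mulVec, dotProduct, metropolis_sub_one_apply, sub_mul, mul_sub,
    Finset.sum_sub_distrib]
  simp [Finset.sum_mul]

theorem sum_mulVec_metropolis_sub_one (v : Fin n → ℝ) :
    ∑ i, ((metropolis G - 1).mulVec v) i = 0 := by
  simp only [Matrix.mulVec, dotProduct]
  rw [Finset.sum_comm]
  refine Finset.sum_eq_zero fun j _ => ?_
  rw [← Finset.sum_mul, Finset.sum_congr rfl fun i _ => ?_, sum_metropolis_sub_one G j, zero_mul]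
  have := congrFun (congrFun ((metropolis_isSymm G).sub Matrix.isSymm_one) j) i
  exact this

/-- The sum of `W i j * (v i - v j) ^ 2` over ordered pairs. -/
noncomputable def dirichlet (v : Fin n → ℝ) : ℝ := ∑ i, ∑ j, mhOff G i j * (v i - v j) ^ 2

theorem dirichlet_eq (v : Fin n → ℝ) :
    dirichlet G v = -2 * ∑ i, v i * ((metropolis G - 1).mulVec v) i := by
  have h1 : dirichlet G v = ∑ i, ∑ j, mhOff G i j * (v i * (v i - v j)) +
      ∑ i, ∑ j, mhOff G i j * (v j * (v j - v i)) := by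
    unfold dirichlet
    simp_rw [← Finset.sum_add_distrib]
    refine Finset.sum_congr rfl fun i _ => Finset.sum_congr rfl fun j _ => ?_
    ring
  have h2 : ∑ i, ∑ j, mhOff G i j * (v j * (v j - v i)) =
      ∑ i, ∑ j, mhOff G i j * (v i * (v i - v j)) := by
    rw [Finset.sum_comm]
    refine Finset.sum_congr rfl fun i _ => Finset.sum_congr rfl fun j _ => ?_
    rw [mhOff_symm]
  rw [h1, h2]
  simp_rw [metropolis_sub_one_mulVec, Finset.mul_sum]
  rw [← Finset.sum_add_distrib]
  refine Finset.sum_congr rfl fun i _ => ?_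
  rw [← Finset.sum_add_distrib]
  refine Finset.sum_congr rfl fun j _ => ?_
  ring

theorem dirichlet_le (v : Fin n → ℝ) : dirichlet G v ≤ 4 * ∑ i, v i ^ 2 := by
  have h1 : dirichlet G v ≤ ∑ i, ∑ j, mhOff G i j * (2 * v i ^ 2) +
      ∑ i, ∑ j, mhOff G i j * (2 * v j ^ 2) := by
    unfold dirichlet
    simp_rw [← Finset.sum_add_distrib]
    refine Finset.sum_le_sum fun i _ => Finset.sum_le_sum fun j _ => ?_
    rw [← mul_add]
    refine mul_le_mul_of_nonneg_left ?_ (mhOff_nonneg G i j)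
    nlinarith [sq_nonneg (v i + v j)]
  have h2 : ∑ i, ∑ j, mhOff G i j * (2 * v j ^ 2) = ∑ i, ∑ j, mhOff G i j * (2 * v i ^ 2) := by
    rw [Finset.sum_comm]
    refine Finset.sum_congr rfl fun i _ => Finset.sum_congr rfl fun j _ => ?_
    rw [mhOff_symm]
  have h3 : ∑ i, ∑ j, mhOff G i j * (2 * v i ^ 2) ≤ ∑ i, 2 * v i ^ 2 := by
    refine Finset.sum_le_sum fun i _ => ?_
    rw [← Finset.sum_mul]
    exact mul_le_of_le_one_left (by positivity) (sum_mhOff_le_one G i)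
  rw [← Finset.mul_sum] at h3
  linarith

/-- Off-diagonal weights in a row sum to at most `1`, so Cauchy–Schwarz bounds each squared
coordinate by the Dirichlet sum of its row. -/
theorem sum_sq_metropolis_sub_one_mulVec_le (v : Fin n → ℝ) :
    ∑ i, ((metropolis G - 1).mulVec v) i ^ 2 ≤ 4 * ∑ i, v i ^ 2 := by
  refine le_trans (Finset.sum_le_sum fun i _ => ?_) (dirichlet_le G v)
  rw [metropolis_sub_one_mulVec]
  have h := Finset.sum_mul_sq_le_sq_mul_sq Finset.univ (fun j => √(mhOff G i j))
    (fun j => √(mhOff G i j) * (v j - v i))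
  simp_rw [mul_pow, ← mul_assoc, Real.mul_self_sqrt (mhOff_nonneg G i _),
    Real.sq_sqrt (mhOff_nonneg G i _)] at h
  refine h.trans ((mul_le_of_le_one_left ?_ (sum_mhOff_le_one G i)).trans_eq ?_)
  · exact Finset.sum_nonneg fun j _ => mul_nonneg (mhOff_nonneg G i j) (sq_nonneg _)
  · refine Finset.sum_congr rfl fun j _ => ?_
    ring

/-- Double counting of closed neighbourhoods: a vertex `x` can lie only in those of the `u m` with
`|m - dist i x| ≤ 1`, hence in at most three. -/
theorem sum_degree_geodesic_le (hG : G.Connected) (i : Fin n) (L : ℕ) (u : ℕ → Fin n)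
    (hu : ∀ m ≤ L, G.dist i (u m) = m) :
    ∑ m ∈ Finset.range (L + 1), (G.degree (u m) + 1) ≤ 3 * n := by
  have h1 : ∀ m, G.degree (u m) + 1 = (Finset.univ.filter fun x => x = u m ∨ G.Adj (u m) x).card := by
    intro m
    rw [Finset.filter_or, Finset.card_union_of_disjoint, Finset.filter_eq',
      ← SimpleGraph.neighborFinset_eq_filter, SimpleGraph.card_neighborFinset_eq_degree]
    · simp [add_comm]
    · rw [Finset.disjoint_filter]
      rintro x - rfl
      exact G.irrefl
  simp_rw [h1, Finset.card_filter]
  rw [Finset.sum_comm]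
  refine (Finset.sum_le_card_nsmul _ _ 3 fun x _ => ?_).trans_eq (by simp [mul_comm])
  rw [← Finset.card_filter]
  refine (Finset.card_le_card (t := Finset.Icc (G.dist i x - 1) (G.dist i x + 1)) ?_).trans ?_
  · intro m hm
    simp only [Finset.mem_filter, Finset.mem_range] at hm
    have hd := hu m (by omega)
    rw [Finset.mem_Icc]
    rcases hm.2 with h | h
    · subst h; omega
    · have h1 : G.dist i x ≤ G.dist i (u m) + G.dist (u m) x := hG.dist_triangle
      have h2 : G.dist i (u m) ≤ G.dist i x + G.dist x (u m) := hG.dist_triangle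
      rw [SimpleGraph.dist_eq_one_iff_adj.2 h] at h1
      rw [SimpleGraph.dist_eq_one_iff_adj.2 h.symm] at h2
      omega
  · rw [Nat.card_Icc]; omega

/-- An effective-resistance bound. Cauchy–Schwarz along a geodesic separates the resistances `1 / W`
from the energy. A resistance is at most the sum of the two closed-neighbourhood sizes, so the total
is at most `2 · 3n`. -/
theorem sq_sub_le_dirichlet (hG : G.Connected) (v : Fin n → ℝ) (i j : Fin n) :
    (v i - v j) ^ 2 ≤ 6 * n * dirichlet G v := by
  obtain ⟨L, u, rfl, rfl, hadj, hdist⟩ := exists_geodesic G hG i j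
  have hpos : ∀ m ∈ Finset.range L, 0 < mhOff G (u m) (u (m + 1)) := by
    intro m hm
    rw [mhOff, if_pos (hadj m (Finset.mem_range.1 hm))]
    positivity
  have htel : v (u L) - v (u 0) = ∑ m ∈ Finset.range L, (v (u (m + 1)) - v (u m)) :=
    (Finset.sum_range_sub (fun m => v (u m)) L).symm
  have hcs := Finset.sum_sq_le_sum_mul_sum_of_sq_le_mul (Finset.range L)
    (r := fun m => v (u (m + 1)) - v (u m))
    (f := fun m => (mhOff G (u m) (u (m + 1)))⁻¹)
    (g := fun m => mhOff G (u m) (u (m + 1)) * (v (u m) - v (u (m + 1))) ^ 2)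
    (fun m hm => (inv_pos.2 (hpos m hm)).le)
    (fun m hm => mul_nonneg (hpos m hm).le (sq_nonneg _))
    (fun m hm => by
      rw [inv_mul_cancel_left₀ (hpos m hm).ne']
      apply le_of_eq; ring)
  rw [← htel] at hcs
  have hR : ∑ m ∈ Finset.range L, (mhOff G (u m) (u (m + 1)))⁻¹ ≤ 6 * n := by
    have h1 : ∀ m ∈ Finset.range L, (mhOff G (u m) (u (m + 1)))⁻¹ ≤
        ((G.degree (u m) + 1 : ℕ) : ℝ) + ((G.degree (u (m + 1)) + 1 : ℕ) : ℝ) := by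
      intro m hm
      rw [mhOff, if_pos (hadj m (Finset.mem_range.1 hm)), one_div, inv_inv]
      exact_mod_cast max_le (by omega) (by omega)
    refine (Finset.sum_le_sum h1).trans ?_
    have h2 := sum_degree_geodesic_le G hG _ L u hdist
    have h3 := h2
    rw [Finset.sum_range_succ] at h2
    rw [Finset.sum_range_succ'] at h3
    rw [Finset.sum_add_distrib]
    have : ∑ m ∈ Finset.range L, (G.degree (u m) + 1) +
      ∑ m ∈ Finset.range L, (G.degree (u (m + 1)) + 1) ≤ 6 * n := by omega
    exact_mod_cast this
  have hE : ∑ m ∈ Finset.range L, mhOff G (u m) (u (m + 1)) * (v (u m) - v (u (m + 1))) ^ 2 ≤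
      dirichlet G v := by
    -- Distance from the start separates the edges of the geodesic, so each is counted once in the
    -- Dirichlet sum.
    have hinj : Set.InjOn (fun m => (u m, u (m + 1))) (Finset.range L : Set ℕ) := by
      intro a ha b hb hab
      simp only [Finset.coe_range, Set.mem_Iio] at ha hb
      have h := congrArg Prod.fst hab
      simp only at h
      rw [← hdist a ha.le, ← hdist b hb.le, h]
    unfold dirichlet
    rw [← Finset.sum_product', ← Finset.sum_image
      (f := fun p : Fin n × Fin n => mhOff G p.1 p.2 * (v p.1 - v p.2) ^ 2) hinj]
    exact Finset.sum_le_sum_of_subset_of_nonneg (fun _ _ => by simp)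
      fun p _ _ => mul_nonneg (mhOff_nonneg G _ _) (sq_nonneg _)
  calc (v (u 0) - v (u L)) ^ 2 = (v (u L) - v (u 0)) ^ 2 := by ring
    _ ≤ _ := hcs
    _ ≤ _ := mul_le_mul hR hE (Finset.sum_nonneg fun m hm => mul_nonneg (hpos m hm).le (sq_nonneg _))
      (by positivity)

theorem sum_sq_le_dirichlet (hG : G.Connected) (v : Fin n → ℝ) (hv : ∑ i, v i = 0) :
    ∑ i, v i ^ 2 ≤ 6 * n ^ 2 * dirichlet G v := by
  have h : ∀ i ∈ Finset.univ, v i ^ 2 ≤ 6 * n * dirichlet G v := by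
    intro i _
    -- Since `v` sums to zero, some `v j` does not have the strict sign of `v i`; then `v i ^ 2 ≤ (v
    -- i - v j) ^ 2`.
    have hex : ∃ j, v i * v j ≤ 0 := by
      by_contra! hcon
      have : 0 < ∑ j, v i * v j := Finset.sum_pos (fun j _ => hcon j) ⟨i, Finset.mem_univ i⟩
      rw [← Finset.mul_sum, hv, mul_zero] at this
      exact this.false
    obtain ⟨j, hj⟩ := hex
    refine le_trans ?_ (sq_sub_le_dirichlet G hG v i j)
    nlinarith [sq_nonneg (v j)]
  refine (Finset.sum_le_card_nsmul _ _ _ h).trans_eq ?_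
  simp only [Finset.card_univ, Fintype.card_fin, nsmul_eq_mul]
  ring

/-- Orthogonal diagonalization of `1 - W` with the spectral gap: every eigenvector of `1 - W` is
constant, with eigenvalue `0`, or has its eigenvalue in `[1 / (12 n²), 2]`. -/
theorem exists_modes (hG : G.Connected) :
    ∃ (U : Matrix (Fin n) (Fin n) ℝ) (μ : Fin n → ℝ),
      U * U.transpose = 1 ∧ U.transpose * (metropolis G - 1) = Matrix.diagonal (-μ) * U.transpose ∧
      ∀ k, (μ k = 0 ∧ ∀ i j, U i k = U j k) ∨ (1 ≤ 12 * n ^ 2 * μ k ∧ μ k ≤ 2) := by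
  have hB : (metropolis G - 1).IsHermitian := by
    have h := (metropolis_isSymm G).sub Matrix.isSymm_one
    rw [Matrix.IsHermitian, Matrix.conjTranspose_eq_transpose_of_trivial]
    exact h
  set U : Matrix (Fin n) (Fin n) ℝ := (hB.eigenvectorUnitary).1 with hU
  have hUU : U * U.transpose = 1 := by
    have := Unitary.mul_star_self_of_mem hB.eigenvectorUnitary.2
    rwa [Matrix.star_eq_conjTranspose, Matrix.conjTranspose_eq_transpose_of_trivial] at this
  have hUU' : U.transpose * U = 1 := mul_eq_one_comm.1 hUU
  have heig : ∀ k, (metropolis G - 1).mulVec (fun i => U i k) =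
      hB.eigenvalues k • fun i => U i k := by
    intro k
    have := hB.mulVec_eigenvectorBasis k
    have h : (fun i => U i k) = (hB.eigenvectorBasis k).ofLp := by
      funext i
      exact hB.eigenvectorUnitary_apply i k
    rwa [h]
  have hsq : ∀ k, ∑ i, U i k ^ 2 = 1 := by
    intro k
    have := congrFun (congrFun hUU' k) k
    rw [Matrix.mul_apply, Matrix.one_apply_eq] at this
    simpa [sq] using this
  refine ⟨U, fun k => -hB.eigenvalues k, hUU, ?_, fun k => ?_⟩
  · have h1 : (metropolis G - 1) * U = U * Matrix.diagonal hB.eigenvalues := by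
      ext i k
      rw [Matrix.mul_diagonal]
      have := congrFun (heig k) i
      simp only [Pi.smul_apply, smul_eq_mul] at this
      rw [mul_comm, ← this]
      rfl
    have h2 := congrArg Matrix.transpose h1
    rw [Matrix.transpose_mul, Matrix.transpose_mul, Matrix.diagonal_transpose,
      ((metropolis_isSymm G).sub Matrix.isSymm_one).eq] at h2
    rw [h2]
    congr 2
    ext i; simp
  -- For a unit eigenvector the Dirichlet sum is twice the eigenvalue of `1 - W`; the Poincaré bound
  -- and `dirichlet_le` become the two ends of the interval.
  · have hE := dirichlet_eq G (fun i => U i k)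
    simp only [heig, Pi.smul_apply, smul_eq_mul] at hE
    have h1 : ∑ i, U i k * (hB.eigenvalues k * U i k) = hB.eigenvalues k := by
      calc _ = hB.eigenvalues k * ∑ i, U i k ^ 2 := by
            rw [Finset.mul_sum]
            exact Finset.sum_congr rfl fun i _ => by ring
        _ = _ := by rw [hsq, mul_one]
    rw [h1] at hE
    by_cases h0 : hB.eigenvalues k = 0
    · left
      refine ⟨by simp [h0], fun i j => ?_⟩
      have := sq_sub_le_dirichlet G hG (fun i => U i k) i j
      rw [hE, h0] at this
      simp only [mul_zero] at this
      have := pow_eq_zero_iff (two_ne_zero) |>.1 (le_antisymm this (sq_nonneg _))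
      linarith
    · right
      have hs : ∑ i, U i k = 0 := by
        have := sum_mulVec_metropolis_sub_one G (fun i => U i k)
        simp only [heig, Pi.smul_apply, smul_eq_mul, ← Finset.mul_sum] at this
        exact (mul_eq_zero.1 this).resolve_left h0
      have h2 := sum_sq_le_dirichlet G hG _ hs
      have h3 := dirichlet_le G (fun i => U i k)
      rw [hE] at h2 h3
      simp only [hsq] at h2 h3
      constructor <;> linarith

theorem specNorm_metropolis_sub_one_le : specNorm (metropolis G - 1) ≤ 2 := by
  refine ContinuousLinearMap.opNorm_le_bound _ (by norm_num) fun x => ?_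
  rw [← sq_le_sq₀ (norm_nonneg _) (by positivity), mul_pow, EuclideanSpace.norm_sq_eq,
    EuclideanSpace.norm_sq_eq]
  have := sum_sq_metropolis_sub_one_mulVec_le G x.ofLp
  simp only [Real.norm_eq_abs, sq_abs, Matrix.ofLp_toEuclideanCLM]
  linarith

/-- At a vertex of maximal degree `D ≥ 1` all neighbours have weight `1 / (D + 1)`, so the diagonal
entry of `W - I` is `-D / (D + 1)`. -/
theorem half_le_specNorm_metropolis_sub_one (hG : G.Connected) (hn : 2 ≤ n) :
    1 / 2 ≤ specNorm (metropolis G - 1) := by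
  have : Nonempty (Fin n) := ⟨⟨0, by omega⟩⟩
  obtain ⟨i, hi⟩ := G.exists_maximal_degree_vertex
  have hdeg : 1 ≤ G.degree i := by
    have : Nontrivial (Fin n) := Fin.nontrivial_iff_two_le.2 hn
    exact hG.preconnected.degree_pos_of_nontrivial i
  have hsum : 1 / 2 ≤ ∑ j, mhOff G i j := by
    have h : ∀ j, mhOff G i j = if G.Adj i j then 1 / ((G.degree i : ℝ) + 1) else 0 := by
      intro j
      unfold mhOff
      rw [max_eq_left]
      · push_cast; rfl
      · have := G.degree_le_maxDegree j
        omega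
    simp_rw [h]
    rw [← Finset.sum_filter, Finset.sum_const, ← SimpleGraph.neighborFinset_eq_filter,
      SimpleGraph.card_neighborFinset_eq_degree, nsmul_eq_mul, mul_one_div,
      div_le_div_iff₀ (by norm_num) (by positivity)]
    have : (1 : ℝ) ≤ G.degree i := by exact_mod_cast hdeg
    linarith
  refine hsum.trans ?_
  have h1 := (Matrix.toEuclideanCLM (n := Fin n) (𝕜 := ℝ) (metropolis G - 1)).le_opNorm
    (EuclideanSpace.single i 1)
  rw [PiLp.norm_single, norm_one, mul_one] at h1
  refine le_trans ?_ h1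
  refine le_trans ?_ (PiLp.norm_apply_le _ i)
  have : (Matrix.toEuclideanCLM (n := Fin n) (𝕜 := ℝ) (metropolis G - 1)
      (EuclideanSpace.single i 1)) i = (metropolis G - 1) i i := by
    rw [Matrix.ofLp_toEuclideanCLM]
    simp [-Matrix.sub_apply]
  rw [this, metropolis_sub_one_apply, mhOff_self, if_pos rfl, zero_sub, norm_neg]
  exact le_abs_self _

end Graph

/-! ### Frobenius norm and matrix action on rows -/

section Rows

variable {n d : ℕ}

theorem frob_eq_norm (X : Rows n d) : frob X = ‖(WithLp.toLp 2 X : PiLp 2 fun _ : Fin n => Vec d)‖ := by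
  rw [PiLp.norm_eq_of_L2]
  rfl

theorem frob_nonneg (X : Rows n d) : 0 ≤ frob X := Real.sqrt_nonneg _

theorem frob_sq (X : Rows n d) : frob X ^ 2 = ∑ i, ‖X i‖ ^ 2 :=
  Real.sq_sqrt (Finset.sum_nonneg fun _ _ => sq_nonneg _)

theorem frob_add_le (X Y : Rows n d) : frob (X + Y) ≤ frob X + frob Y := by
  simp only [frob_eq_norm, WithLp.toLp_add]
  exact norm_add_le _ _

theorem frob_sub_le (X Y : Rows n d) : frob (X - Y) ≤ frob X + frob Y := by
  simp only [frob_eq_norm, WithLp.toLp_sub]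
  exact norm_sub_le _ _

theorem frob_smul (c : ℝ) (X : Rows n d) : frob (c • X) = |c| * frob X := by
  simp only [frob_eq_norm, WithLp.toLp_smul, norm_smul, Real.norm_eq_abs]

theorem act_add (A : Matrix (Fin n) (Fin n) ℝ) (X Y : Rows n d) :
    act A (X + Y) = act A X + act A Y := by
  funext i
  simp [act, Finset.sum_add_distrib]

theorem act_sub (A : Matrix (Fin n) (Fin n) ℝ) (X Y : Rows n d) :
    act A (X - Y) = act A X - act A Y := by
  funext i
  simp [act, smul_sub, Finset.sum_sub_distrib]

theorem act_smul (A : Matrix (Fin n) (Fin n) ℝ) (c : ℝ) (X : Rows n d) :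
    act A (c • X) = c • act A X := by
  funext i
  simp [act, Finset.smul_sum, smul_comm c]

theorem act_mul (A B : Matrix (Fin n) (Fin n) ℝ) (X : Rows n d) :
    act (A * B) X = act A (act B X) := by
  funext i
  simp only [act, Matrix.mul_apply, Finset.sum_smul, Finset.smul_sum, mul_smul]
  rw [Finset.sum_comm]

theorem act_diagonal (w : Fin n → ℝ) (X : Rows n d) (i : Fin n) :
    act (Matrix.diagonal w) X i = w i • X i := by
  simp [act, Matrix.diagonal_apply, ite_smul]

theorem frob_act_of_orthogonal (A : Matrix (Fin n) (Fin n) ℝ) (hA : A.transpose * A = 1)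
    (X : Rows n d) : frob (act A X) = frob X := by
  unfold frob
  congr 1
  have h : ∀ i j, ∑ k, A k i * A k j = if i = j then 1 else 0 := by
    intro i j
    have := congrFun (congrFun hA i) j
    rwa [Matrix.mul_apply, Matrix.one_apply] at this
  calc ∑ k, ‖act A X k‖ ^ 2 = ∑ k, ∑ i, ∑ j, (A k i * A k j) * inner ℝ (X i) (X j) := by
        refine Finset.sum_congr rfl fun k _ => ?_
        rw [← real_inner_self_eq_norm_sq, act, sum_inner]
        refine Finset.sum_congr rfl fun i _ => ?_
        rw [inner_sum]
        refine Finset.sum_congr rfl fun j _ => ?_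
        rw [real_inner_smul_left, real_inner_smul_right]
        ring
    _ = ∑ i, ∑ j, (∑ k, A k i * A k j) * inner ℝ (X i) (X j) := by
        rw [Finset.sum_comm]
        refine Finset.sum_congr rfl fun i _ => ?_
        rw [Finset.sum_comm]
        refine Finset.sum_congr rfl fun j _ => ?_
        rw [Finset.sum_mul]
    _ = ∑ i, ‖X i‖ ^ 2 := by
        refine Finset.sum_congr rfl fun i _ => ?_
        simp [h]

end Rows

/-! ### The invariant quadratic form of one mode -/

section Modes

variable {E : Type*} [NormedAddCommGroup E] [InnerProductSpace ℝ E]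

/-- The quadratic form that the heavy-ball type recursion `(x, y) ↦ ((1 + σ) w x - σ y, w x)`,
`w = 1 - δ`, `σ = (1 - q) / (1 + q)`, multiplies by `σ w`. It vanishes for `δ = 0`. -/
noncomputable def modeForm (δ q : ℝ) (x y : E) : ℝ :=
  (1 - δ) / δ * ‖x - (1 + q)⁻¹ • y‖ ^ 2 + (δ - q ^ 2) / δ / (1 + q) ^ 2 * ‖y‖ ^ 2

theorem norm_sq_smul_add_smul (a b : ℝ) (x y : E) :
    ‖a • x + b • y‖ ^ 2 = a ^ 2 * ‖x‖ ^ 2 + 2 * a * b * inner ℝ x y + b ^ 2 * ‖y‖ ^ 2 := by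
  rw [norm_add_sq_real, norm_smul, norm_smul, real_inner_smul_left, real_inner_smul_right, mul_pow,
    mul_pow, Real.norm_eq_abs, Real.norm_eq_abs, sq_abs, sq_abs]
  ring

theorem modeForm_eq (δ q : ℝ) (x y : E) : modeForm δ q x y =
    (1 - δ) / δ * (‖x‖ ^ 2 - 2 * (1 + q)⁻¹ * inner ℝ x y + ((1 + q)⁻¹) ^ 2 * ‖y‖ ^ 2) +
      (δ - q ^ 2) / δ / (1 + q) ^ 2 * ‖y‖ ^ 2 := by
  have := norm_sq_smul_add_smul 1 (-(1 + q)⁻¹) x y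
  rw [one_smul, neg_smul, ← sub_eq_add_neg] at this
  rw [modeForm, this]
  ring

/-- The factor `σ (1 - δ)` is the determinant of the two-dimensional recursion. At `δ = 0` both
sides vanish, since division by zero gives `0`. -/
theorem modeForm_step (δ q : ℝ) (hq : 0 ≤ q) (x y : E) :
    modeForm δ q ((1 + (1 - q) / (1 + q)) • (1 - δ) • x - ((1 - q) / (1 + q)) • y) ((1 - δ) • x) =
      (1 - q) / (1 + q) * (1 - δ) * modeForm δ q x y := by
  rcases eq_or_ne δ 0 with rfl | hδ
  · simp [modeForm]
  have h1 : (1 + (1 - q) / (1 + q)) • (1 - δ) • x - ((1 - q) / (1 + q)) • y =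
      ((1 + (1 - q) / (1 + q)) * (1 - δ)) • x + (-((1 - q) / (1 + q))) • y := by
    rw [mul_smul, neg_smul, sub_eq_add_neg]
  rw [h1, modeForm_eq, modeForm_eq, norm_sq_smul_add_smul, inner_add_left, real_inner_smul_left,
    real_inner_smul_left, real_inner_smul_right, real_inner_smul_right, real_inner_self_eq_norm_sq,
    norm_smul, mul_pow (‖1 - δ‖), Real.norm_eq_abs, sq_abs, real_inner_comm]
  have hq' : 1 + q ≠ 0 := by positivity
  field_simp
  ring

/-- The forcing satisfies `x - y / (1 + q) = y / (1 + q)`, so the two coefficients add up to a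
multiple of `(1 - q²) / δ`. Only one factor `δ` of `δ²` is lost; this is the source of `√γ` in the
forcing bound. -/
theorem modeForm_forcing_le (δ q : ℝ) (hq : 0 ≤ q) (hδ : 0 ≤ δ) (e : E) :
    modeForm δ q ((1 + (1 - q) / (1 + q)) • (-δ) • e) ((-δ) • e) ≤ δ * ‖e‖ ^ 2 := by
  rcases eq_or_ne δ 0 with rfl | hδ'
  · simp [modeForm]
  have hq' : 1 + q ≠ 0 := by positivity
  have h : modeForm δ q ((1 + (1 - q) / (1 + q)) • (-δ) • e) ((-δ) • e) =
      (1 - q ^ 2) / (1 + q) ^ 2 * (δ * ‖e‖ ^ 2) := by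
    rw [modeForm, ← sub_smul, norm_smul, norm_smul, Real.norm_eq_abs, Real.norm_eq_abs, mul_pow,
      mul_pow, sq_abs, sq_abs]
    field_simp
    ring
  rw [h]
  refine mul_le_of_le_one_left (by positivity) (div_le_one_of_le₀ ?_ (by positivity))
  nlinarith

theorem modeForm_diag_le (δ q : ℝ) (hq : 0 ≤ q) (x : E) : modeForm δ q x x ≤ ‖x‖ ^ 2 := by
  rcases eq_or_ne δ 0 with rfl | hδ'
  · simp [modeForm]
  have hq' : 1 + q ≠ 0 := by positivity
  have h : modeForm δ q x x = (1 - q ^ 2) / (1 + q) ^ 2 * ‖x‖ ^ 2 := by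
    have : x - (1 + q)⁻¹ • x = (1 - (1 + q)⁻¹) • x := by rw [sub_smul, one_smul]
    rw [modeForm, this, norm_smul, Real.norm_eq_abs, mul_pow, sq_abs]
    field_simp
    ring
  rw [h]
  refine mul_le_of_le_one_left (by positivity) (div_le_one_of_le₀ ?_ (by positivity))
  nlinarith

/-- Only `y` is controlled, uniformly in `δ`: the coefficient of the other square vanishes at `δ =
1`. -/
theorem norm_sq_le_modeForm {δ q : ℝ} (hq : 0 ≤ q) (hq' : q ≤ 1 / 5) (hδ : 0 < δ)
    (hqδ : 2 * q ^ 2 ≤ δ) (hδ' : δ ≤ 1) (x y : E) : ‖y‖ ^ 2 ≤ 4 * modeForm δ q x y := by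
  have h1 : 0 ≤ (1 - δ) / δ * ‖x - (1 + q)⁻¹ • y‖ ^ 2 :=
    mul_nonneg (div_nonneg (by linarith) hδ.le) (sq_nonneg _)
  have h2 : 1 / 4 ≤ (δ - q ^ 2) / δ / (1 + q) ^ 2 := by
    have h3 : 1 / 2 ≤ (δ - q ^ 2) / δ := by
      rw [le_div_iff₀ hδ]
      linarith
    rw [le_div_iff₀ (by positivity)]
    nlinarith
  have h3 := mul_le_mul_of_nonneg_right h2 (sq_nonneg ‖y‖)
  rw [modeForm]
  linarith

end Modes

/-! ### The potential: all modes together -/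

section Potential

variable {n d : ℕ}

/-- A vector whose squared norm is the sum of `modeForm` over the coordinates of `X` and `Y` in the
basis given by the columns of `U`. -/
noncomputable def potential (U : Matrix (Fin n) (Fin n) ℝ) (δ : Fin n → ℝ) (q : ℝ)
    (X Y : Rows n d) : PiLp 2 fun _ : Fin n ⊕ Fin n => Vec d :=
  WithLp.toLp 2 (Sum.elim
    (fun k => √((1 - δ k) / δ k) • (act U.transpose X k - (1 + q)⁻¹ • act U.transpose Y k))
    (fun k => √((δ k - q ^ 2) / δ k / (1 + q) ^ 2) • act U.transpose Y k))

theorem potential_add (U : Matrix (Fin n) (Fin n) ℝ) (δ : Fin n → ℝ) (q : ℝ)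
    (X Y X' Y' : Rows n d) :
    potential U δ q (X + X') (Y + Y') = potential U δ q X Y + potential U δ q X' Y' := by
  ext k : 1
  rcases k with k | k
  · simp only [potential, act_add, Pi.add_apply, PiLp.add_apply, Sum.elim_inl]
    module
  · simp only [potential, act_add, Pi.add_apply, PiLp.add_apply, Sum.elim_inr]
    module

/-- Every mode is stationary (`δ = 0`) or oscillates (`2 q ^ 2 ≤ δ ≤ 1`). -/
def IsGapped (δ : Fin n → ℝ) (q : ℝ) : Prop := ∀ k, δ k = 0 ∨ 0 < δ k ∧ 2 * q ^ 2 ≤ δ k ∧ δ k ≤ 1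

theorem norm_potential_sq (U : Matrix (Fin n) (Fin n) ℝ) {δ : Fin n → ℝ} {q : ℝ}
    (hδ : IsGapped δ q) (X Y : Rows n d) :
    ‖potential U δ q X Y‖ ^ 2 =
      ∑ k, modeForm (δ k) q (act U.transpose X k) (act U.transpose Y k) := by
  rw [PiLp.norm_sq_eq_of_L2, Fintype.sum_sum_type, ← Finset.sum_add_distrib]
  refine Finset.sum_congr rfl fun k _ => ?_
  have h1 : 0 ≤ (1 - δ k) / δ k := by
    rcases hδ k with h | ⟨h, h', h''⟩
    · simp [h]
    · exact div_nonneg (by linarith) h.le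
  have h2 : 0 ≤ (δ k - q ^ 2) / δ k / (1 + q) ^ 2 := by
    rcases hδ k with h | ⟨h, h', h''⟩
    · simp [h]
    · exact div_nonneg (div_nonneg (by nlinarith) h.le) (sq_nonneg _)
  simp only [potential, Sum.elim_inl, Sum.elim_inr, norm_smul, Real.norm_eq_abs, mul_pow, sq_abs,
    Real.sq_sqrt h1, Real.sq_sqrt h2, modeForm]

theorem norm_potential_diag_le {U : Matrix (Fin n) (Fin n) ℝ} (hU : U * U.transpose = 1)
    {δ : Fin n → ℝ} {q : ℝ} (hδ : IsGapped δ q) (hq : 0 ≤ q) (X : Rows n d) :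
    ‖potential U δ q X X‖ ≤ frob X := by
  rw [← sq_le_sq₀ (norm_nonneg _) (frob_nonneg _), norm_potential_sq U hδ,
    ← frob_act_of_orthogonal U.transpose (by rwa [Matrix.transpose_transpose]), frob_sq]
  exact Finset.sum_le_sum fun k _ => modeForm_diag_le _ _ hq _

/-- The potential does not see stationary modes. Their eigenvectors are constant, so the zero row
sum makes the corresponding coordinates of `Y` vanish. -/
theorem frob_le_norm_potential {U : Matrix (Fin n) (Fin n) ℝ} (hU : U * U.transpose = 1)
    {δ : Fin n → ℝ} {q : ℝ} (hδ : IsGapped δ q) (hconst : ∀ k, δ k = 0 → ∀ i j, U i k = U j k)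
    (hq : 0 ≤ q) (hq' : q ≤ 1 / 5) (X Y : Rows n d) (hY : ∑ i, Y i = 0) :
    frob Y ≤ 2 * ‖potential U δ q X Y‖ := by
  rw [← sq_le_sq₀ (frob_nonneg _) (by positivity), mul_pow, norm_potential_sq U hδ,
    ← frob_act_of_orthogonal U.transpose (by rwa [Matrix.transpose_transpose]), frob_sq,
    Finset.mul_sum]
  refine Finset.sum_le_sum fun k _ => ?_
  rcases hδ k with h | ⟨h, h', h''⟩
  · have h0 : act U.transpose Y k = 0 := by
      simp only [act, Matrix.transpose_apply]
      rw [Finset.sum_congr rfl fun j _ => by rw [hconst k h j k], ← Finset.smul_sum, hY, smul_zero]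
    rw [h, h0]
    simp [modeForm]
  · norm_num
    exact norm_sq_le_modeForm hq hq' h h' h'' _ _

theorem norm_potential_step_le {U B : Matrix (Fin n) (Fin n) ℝ} (hU : U * U.transpose = 1)
    {μ δ : Fin n → ℝ} {γ q : ℝ} (hγ : 0 ≤ γ) (hq : 0 ≤ q) (hq' : q ≤ 1 / 5) (hμ : ∀ k, μ k ≤ 2)
    (hB : U.transpose * B = Matrix.diagonal (-μ) * U.transpose)
    (hδμ : ∀ k, δ k = γ * μ k) (hδ : IsGapped δ q) (X Y D : Rows n d) :
    ‖potential U δ q ((1 + (1 - q) / (1 + q)) • (X + γ • act B (X + D)) -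
      ((1 - q) / (1 + q)) • Y) (X + γ • act B (X + D))‖ ≤
      (1 - 9 / 10 * q) * ‖potential U δ q X Y‖ + 2 * √γ * frob D := by
  set σ := (1 - q) / (1 + q) with hσ
  have hσ0 : 0 ≤ σ := div_nonneg (by linarith) (by linarith)
  have hact : ∀ Z : Rows n d, ∀ k, act U.transpose (act B Z) k = -μ k • act U.transpose Z k := by
    intro Z k
    rw [← act_mul, hB, act_mul, act_diagonal]
    rfl
  -- By linearity the round is the uncompressed step plus a forcing by `D`.
  have hsplit : potential U δ q ((1 + σ) • (X + γ • act B (X + D)) - σ • Y)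
      (X + γ • act B (X + D)) =
      potential U δ q ((1 + σ) • (X + γ • act B X) - σ • Y) (X + γ • act B X) +
      potential U δ q ((1 + σ) • γ • act B D) (γ • act B D) := by
    rw [← potential_add, act_add]
    congr 1 <;> module
  rw [hsplit]
  refine (norm_add_le _ _).trans (add_le_add ?_ ?_)
  · rw [← sq_le_sq₀ (norm_nonneg _) (mul_nonneg (by linarith) (norm_nonneg _)), mul_pow,
      norm_potential_sq U hδ, norm_potential_sq U hδ, Finset.mul_sum]
    refine Finset.sum_le_sum fun k _ => ?_
    have hx : act U.transpose (X + γ • act B X) k =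
        (1 - δ k) • act U.transpose X k := by
      rw [act_add, act_smul, Pi.add_apply, Pi.smul_apply, hact, hδμ]
      module
    rw [act_sub, act_smul, act_smul, Pi.sub_apply, Pi.smul_apply, Pi.smul_apply σ, hx, hσ,
      modeForm_step _ _ hq]
    rcases hδ k with h | ⟨h, h', h''⟩
    · rw [h]; simp [modeForm]
    · have h0 := norm_sq_le_modeForm hq hq' h h' h'' (act U.transpose X k) (act U.transpose Y k)
      refine mul_le_mul_of_nonneg_right ?_ (by nlinarith [sq_nonneg ‖act U.transpose Y k‖])
      refine (mul_le_of_le_one_right (hσ ▸ hσ0) (by linarith)).trans ?_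
      -- What remains is `(1 - q) / (1 + q) ≤ (1 - 9q/10)²`, which holds for `0 ≤ q ≤ 1/5`.
      rw [div_le_iff₀ (by linarith)]
      nlinarith [mul_nonneg hq hq, mul_nonneg (mul_nonneg hq hq) hq]
  · rw [← sq_le_sq₀ (norm_nonneg _) (mul_nonneg (by positivity) (frob_nonneg _)), mul_pow,
      norm_potential_sq U hδ, mul_pow, Real.sq_sqrt hγ,
      ← frob_act_of_orthogonal U.transpose (by rwa [Matrix.transpose_transpose]) D, frob_sq,
      Finset.mul_sum]
    refine Finset.sum_le_sum fun k _ => ?_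
    have hx : act U.transpose (γ • act B D) k = (-δ k) • act U.transpose D k := by
      rw [act_smul, Pi.smul_apply, hact, hδμ]
      module
    rw [act_smul, Pi.smul_apply, hx, hσ]
    have h0 : 0 ≤ δ k := by
      rcases hδ k with h | ⟨h, -, -⟩
      · exact h.ge
      · exact h.le
    refine (modeForm_forcing_le _ _ hq h0 _).trans
      (mul_le_mul_of_nonneg_right ?_ (sq_nonneg _))
    rw [hδμ]
    nlinarith [hμ k]

end Potential

/-! ### Measurability and the mean distortion -/

section Compression

variable {n d : ℕ} {Z : Type*}

/-- The difference `X(t) - X̂(t)` that the agents compress in round `t`. -/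
def residual (W : Matrix (Fin n) (Fin n) ℝ) (γ σ : ℝ) (Q : Vec d → Z → Vec d) (X₀ : Rows n d)
    (z : ℕ → Fin n → Z) (t : ℕ) : Rows n d :=
  (run W γ σ Q X₀ z t).x - (run W γ σ Q X₀ z t).xhat

/-- The error made by compressing the rows of `D`. -/
def distortion (Q : Vec d → Z → Vec d) (D : Rows n d) (z : Fin n → Z) : Rows n d :=
  fun i => Q (D i) (z i) - D i

/-- Causality: the state at time `t` depends only on earlier rounds, which makes it independent of
the randomness of round `t`. -/
theorem run_congr (W : Matrix (Fin n) (Fin n) ℝ) (γ σ : ℝ) (Q : Vec d → Z → Vec d)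
    (X₀ : Rows n d) {z z' : ℕ → Fin n → Z} {t : ℕ} (h : ∀ s < t, z s = z' s) :
    run W γ σ Q X₀ z t = run W γ σ Q X₀ z' t := by
  induction t with
  | zero => rfl
  | succ t ih => rw [run, run, ih fun s hs => h s (by omega), h t (by omega)]

variable [MeasurableSpace Z]

theorem measurable_frob : Measurable (frob : Rows n d → ℝ) := by
  unfold frob
  fun_prop

theorem measurable_act (A : Matrix (Fin n) (Fin n) ℝ) : Measurable (act A : Rows n d → Rows n d) := by
  unfold act
  fun_prop

theorem measurable_run (W : Matrix (Fin n) (Fin n) ℝ) (γ σ : ℝ) {Q : Vec d → Z → Vec d}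
    (hQ : Measurable fun p : Vec d × Z => Q p.1 p.2) (X₀ : Rows n d) (t : ℕ) :
    Measurable (fun z => (run W γ σ Q X₀ z t).xhat) ∧
    Measurable (fun z => (run W γ σ Q X₀ z t).y) ∧
    Measurable (fun z => (run W γ σ Q X₀ z t).x) := by
  induction t with
  | zero => exact ⟨measurable_const, measurable_const, measurable_const⟩
  | succ t ih =>
    obtain ⟨h1, h2, h3⟩ := ih
    have hxhat : Measurable (fun z => (run W γ σ Q X₀ z (t + 1)).xhat) := by
      refine measurable_pi_lambda _ fun i => ?_
      have hz : Measurable fun z : ℕ → Fin n → Z => z t i := by fun_prop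
      have h1i := (measurable_pi_apply i).comp h1
      have h3i := (measurable_pi_apply i).comp h3
      exact h1i.add (hQ.comp ((h3i.sub h1i).prodMk hz))
    have hy : Measurable (fun z => (run W γ σ Q X₀ z (t + 1)).y) :=
      h3.add (((measurable_act _).comp hxhat).const_smul γ)
    exact ⟨hxhat, hy, (hy.const_smul (1 + σ)).sub (h2.const_smul σ)⟩

theorem measurable_residual (W : Matrix (Fin n) (Fin n) ℝ) (γ σ : ℝ) {Q : Vec d → Z → Vec d}
    (hQ : Measurable fun p : Vec d × Z => Q p.1 p.2) (X₀ : Rows n d) (t : ℕ) :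
    Measurable (fun z => residual W γ σ Q X₀ z t) :=
  (measurable_run W γ σ hQ X₀ t).2.2.sub (measurable_run W γ σ hQ X₀ t).1

theorem measurable_distortion {Q : Vec d → Z → Vec d}
    (hQ : Measurable fun p : Vec d × Z => Q p.1 p.2) :
    Measurable (fun p : Rows n d × (Fin n → Z) => distortion Q p.1 p.2) := by
  refine measurable_pi_lambda _ fun i => ?_
  have h1 : Measurable fun p : Rows n d × (Fin n → Z) => p.1 i := by fun_prop
  have h2 : Measurable fun p : Rows n d × (Fin n → Z) => p.2 i := by fun_prop
  exact (hQ.comp (h1.prodMk h2)).sub h1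

theorem sq_lintegral_le_lintegral_sq {α : Type*} [MeasurableSpace α] (ν : Measure α)
    [IsProbabilityMeasure ν] {f : α → ENNReal} (hf : Measurable f) :
    (∫⁻ a, f a ∂ν) ^ 2 ≤ ∫⁻ a, f a ^ 2 ∂ν := by
  have h := ENNReal.lintegral_mul_le_Lp_mul_Lq ν Real.HolderConjugate.two_two hf.aemeasurable
    (aemeasurable_const (b := 1))
  simp only [Pi.mul_apply, mul_one, lintegral_const, measure_univ, ENNReal.rpow_two, one_pow,
    ENNReal.one_rpow] at h
  calc _ ≤ ((∫⁻ a, f a ^ 2 ∂ν) ^ (1 / 2 : ℝ)) ^ 2 := by gcongr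
    _ = _ := by
      rw [← ENNReal.rpow_natCast, ← ENNReal.rpow_mul]
      norm_num

/-- Second moments add over the rows, so only the marginal laws matter and the rows may be
dependent. Cauchy–Schwarz passes to the first moment. -/
theorem lintegral_frob_distortion_le {P : Measure Z} {ω : ℝ} (hω : 0 ≤ ω)
    {Q : Vec d → Z → Vec d} (hQ : IsCompressor P ω Q) (ν : Measure (Fin n → Z))
    [IsProbabilityMeasure ν] (hν : ∀ i, ν.map (fun z => z i) = P) (D : Rows n d) :
    ∫⁻ z, ENNReal.ofReal (frob (distortion Q D z)) ∂ν ≤ ENNReal.ofReal (ω * frob D) := by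
  have hm : Measurable fun z : Fin n → Z => distortion Q D z :=
    (measurable_distortion hQ.measurable).comp (measurable_const.prodMk measurable_id)
  have hrow : ∀ i, ∫⁻ z, ENNReal.ofReal (‖distortion Q D z i‖ ^ 2) ∂ν ≤
      ENNReal.ofReal (ω ^ 2 * ‖D i‖ ^ 2) := by
    intro i
    refine le_trans (le_of_eq ?_) (hQ.error_le (D i))
    rw [← hν i, lintegral_map _ (measurable_pi_apply i)]
    · rfl
    · have : Measurable fun z => Q (D i) z :=
        hQ.measurable.comp (measurable_const.prodMk measurable_id)
      fun_prop
  rw [← ENNReal.pow_le_pow_left_iff two_ne_zero]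
  refine (sq_lintegral_le_lintegral_sq ν (measurable_frob.comp hm).ennreal_ofReal).trans ?_
  calc ∫⁻ z, ENNReal.ofReal (frob (distortion Q D z)) ^ 2 ∂ν
      = ∫⁻ z, ∑ i, ENNReal.ofReal (‖distortion Q D z i‖ ^ 2) ∂ν := by
        refine lintegral_congr fun z => ?_
        rw [← ENNReal.ofReal_pow (frob_nonneg _), frob_sq,
          ENNReal.ofReal_sum_of_nonneg fun _ _ => sq_nonneg _]
    _ = ∑ i, ∫⁻ z, ENNReal.ofReal (‖distortion Q D z i‖ ^ 2) ∂ν := by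
        refine lintegral_finsetSum _ fun i _ => ?_
        exact (((measurable_pi_apply i).comp hm).norm.pow_const 2).ennreal_ofReal
    _ ≤ ∑ i, ENNReal.ofReal (ω ^ 2 * ‖D i‖ ^ 2) := Finset.sum_le_sum fun i _ => hrow i
    _ = ENNReal.ofReal (ω * frob D) ^ 2 := by
        rw [← ENNReal.ofReal_sum_of_nonneg fun _ _ => by positivity, ← Finset.mul_sum,
          ← frob_sq, ← mul_pow, ENNReal.ofReal_pow (mul_nonneg hω (frob_nonneg _))]

/-- Conditioning on the past without conditional expectations: the joint law of the past and round
`t` is a product, and Tonelli lets the past be frozen. -/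
theorem lintegral_frob_distortion_residual_le {P : Measure Z} [IsProbabilityMeasure P] {ω : ℝ}
    (hω : 0 ≤ ω) {Q : Vec d → Z → Vec d} (hQ : IsCompressor P ω Q)
    {Ω : Type*} [MeasurableSpace Ω] (μ : Measure Ω) [IsProbabilityMeasure μ]
    {ζ : ℕ → Fin n → Ω → Z} (hζ : ∀ t i, Measurable (ζ t i))
    (hlaw : ∀ t i, Measure.map (ζ t i) μ = P)
    (hind : iIndepFun (fun (t : ℕ) (w : Ω) (i : Fin n) => ζ t i w) μ)
    (W : Matrix (Fin n) (Fin n) ℝ) (γ σ : ℝ) (X₀ : Rows n d) (t : ℕ) :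
    ∫⁻ w, ENNReal.ofReal (frob (distortion Q
        (residual W γ σ Q X₀ (fun s i => ζ s i w) t) (fun i => ζ t i w))) ∂μ ≤
      ENNReal.ofReal ω *
        ∫⁻ w, ENNReal.ofReal (frob (residual W γ σ Q X₀ (fun s i => ζ s i w) t)) ∂μ := by
  classical
  obtain ⟨z₀⟩ : Nonempty Z := nonempty_of_isProbabilityMeasure P
  have hζ' : ∀ s, Measurable fun w i => ζ s i w := fun s => measurable_pi_lambda _ (hζ s)
  set H : Ω → (Finset.range t → Fin n → Z) := fun w s i => ζ s i w with hH
  have hHm : Measurable H := measurable_pi_lambda _ fun s => hζ' s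
  -- The past is padded by an arbitrary `z₀`, which the state at time `t` never reads.
  set ext : (Finset.range t → Fin n → Z) → (ℕ → Fin n → Z) :=
    fun h s => if hs : s ∈ Finset.range t then h ⟨s, hs⟩ else fun _ => z₀ with hext
  have hextm : Measurable ext := by
    refine measurable_pi_lambda _ fun s => ?_
    by_cases hs : s ∈ Finset.range t
    · simp only [hext, dif_pos hs]
      exact measurable_pi_apply _
    · simp only [hext, dif_neg hs]
      exact measurable_const
  set R : (Finset.range t → Fin n → Z) → Rows n d :=
    fun h => residual W γ σ Q X₀ (ext h) t with hR
  have hRm : Measurable R := (measurable_residual W γ σ hQ.measurable X₀ t).comp hextm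
  have hres : ∀ w, residual W γ σ Q X₀ (fun s i => ζ s i w) t = R (H w) := by
    intro w
    have : run W γ σ Q X₀ (fun s i => ζ s i w) t = run W γ σ Q X₀ (ext (H w)) t := by
      refine run_congr _ _ _ _ _ fun s hs => ?_
      simp only [hext, dif_pos (Finset.mem_range.2 hs), hH]
    simp only [hR, residual, this]
  have hindep : IndepFun H (fun w i => ζ t i w) μ := by
    have h := hind.indepFun_finset (Finset.range t) {t} (by simp) hζ'
    exact h.comp measurable_id (measurable_pi_apply (⟨t, Finset.mem_singleton_self t⟩ : ({t} : Finset ℕ)))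
  have hmap := (indepFun_iff_map_prod_eq_prod_map_map hHm.aemeasurable (hζ' t).aemeasurable).1 hindep
  have : IsProbabilityMeasure (μ.map fun w i => ζ t i w) :=
    Measure.isProbabilityMeasure_map (hζ' t).aemeasurable
  have : IsProbabilityMeasure (μ.map H) := Measure.isProbabilityMeasure_map hHm.aemeasurable
  have hΦ : Measurable fun p : (Finset.range t → Fin n → Z) × (Fin n → Z) =>
      ENNReal.ofReal (frob (distortion Q (R p.1) p.2)) :=
    (measurable_frob.comp ((measurable_distortion hQ.measurable).comp
      ((hRm.comp measurable_fst).prodMk measurable_snd))).ennreal_ofReal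
  simp_rw [hres]
  calc ∫⁻ w, ENNReal.ofReal (frob (distortion Q (R (H w)) (fun i => ζ t i w))) ∂μ
      = ∫⁻ p, ENNReal.ofReal (frob (distortion Q (R p.1) p.2))
          ∂(μ.map fun w => (H w, fun i => ζ t i w)) :=
        (lintegral_map hΦ (hHm.prodMk (hζ' t))).symm
    _ = ∫⁻ h, ∫⁻ z, ENNReal.ofReal (frob (distortion Q (R h) z)) ∂(μ.map fun w i => ζ t i w)
          ∂(μ.map H) := by
        rw [hmap, lintegral_prod _ hΦ.aemeasurable]
    _ ≤ ∫⁻ h, ENNReal.ofReal ω * ENNReal.ofReal (frob (R h)) ∂(μ.map H) := by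
        refine lintegral_mono fun h => ?_
        rw [← ENNReal.ofReal_mul hω]
        refine lintegral_frob_distortion_le hω hQ _ (fun i => ?_) _
        rw [Measure.map_map (measurable_pi_apply i) (hζ' t), ← hlaw t i]
        rfl
    _ = ENNReal.ofReal ω * ∫⁻ w, ENNReal.ofReal (frob (R (H w))) ∂μ := by
        have hm : Measurable fun h => ENNReal.ofReal (frob (R h)) :=
          (measurable_frob.comp hRm).ennreal_ofReal
        rw [lintegral_const_mul _ hm, lintegral_map hm hHm]

end Compression

/-! ### Size of the threshold -/

section Parameters

theorem momentum_eq {n : ℕ} (hn : 1 ≤ n) (γ : ℝ) :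
    momentum n γ = (1 - √γ / (5 * n)) / (1 + √γ / (5 * n)) := by
  have : (0 : ℝ) < n := by exact_mod_cast hn
  have h2 : (0 : ℝ) < 5 * n + √γ := by positivity
  rw [momentum]
  field_simp

theorem step_ratio_le {n : ℕ} (hn : 1 ≤ n) {γ : ℝ} (hγ : γ ≤ 1 / 2) : √γ / (5 * n) ≤ 1 / 5 := by
  have h1 : (1 : ℝ) ≤ n := by exact_mod_cast hn
  have h2 : √γ ≤ 1 := Real.sqrt_le_one.2 (by linarith)
  rw [div_le_iff₀ (by positivity)]
  linarith

theorem momentum_mem {n : ℕ} (hn : 1 ≤ n) {γ : ℝ} (hγ : γ ≤ 1 / 2) :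
    0 ≤ momentum n γ ∧ momentum n γ ≤ 1 := by
  have h1 := step_ratio_le hn hγ
  have h2 : 0 ≤ √γ / (5 * n) := by positivity
  rw [momentum_eq hn]
  exact ⟨div_nonneg (by linarith) (by linarith), div_le_one_of_le₀ (by linarith) (by linarith)⟩

theorem kappa2_mem {n : ℕ} (hn : 1 ≤ n) {γ : ℝ} (hγ : γ ≤ 1 / 2) :
    1 ≤ kappa2 n γ ∧ kappa2 n γ ≤ 3 := by
  obtain ⟨h1, h2⟩ := momentum_mem hn hγ
  constructor
  · rw [kappa2, Real.one_le_sqrt]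
    nlinarith
  · rw [kappa2, Real.sqrt_le_left (by norm_num)]
    nlinarith

theorem kappa3_mem {n : ℕ} (hn : 1 ≤ n) {γ : ℝ} (hγ : γ ≤ 1 / 2) :
    1 ≤ kappa3 n γ ∧ kappa3 n γ ≤ 2 := by
  obtain ⟨h1, h2⟩ := momentum_mem hn hγ
  constructor
  · rw [kappa3, Real.one_le_sqrt]
    nlinarith
  · rw [kappa3, Real.sqrt_le_left (by norm_num)]
    nlinarith

theorem inv_sqrt_rate_mem {q : ℝ} (hq : 0 ≤ q) (hq' : q ≤ 1 / 5) :
    1 ≤ (√(1 - q))⁻¹ ∧ (√(1 - q))⁻¹ ≤ 5 / 4 := by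
  have h0 : 4 / 5 ≤ √(1 - q) := Real.le_sqrt_of_sq_le (by nlinarith)
  constructor
  · exact (one_le_inv₀ (by linarith)).2 (Real.sqrt_le_one.2 (by linarith))
  · rw [inv_le_comm₀ (by linarith) (by norm_num)]
    linarith

theorem inv_rate_mem {q : ℝ} (hq : 0 ≤ q) (hq' : q ≤ 1 / 5) :
    1 ≤ (1 - q)⁻¹ ∧ (1 - q)⁻¹ ≤ 5 / 4 := by
  constructor
  · exact (one_le_inv₀ (by linarith)).2 (by linarith)
  · rw [inv_le_comm₀ (by linarith) (by norm_num)]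
    linarith

theorem inv_sq_one_sub_sqrt_mem {q : ℝ} (hq : 0 < q) (hq' : q ≤ 1 / 5) :
    (q ^ 2)⁻¹ ≤ ((1 - √(1 - q)) ^ 2)⁻¹ ∧ ((1 - √(1 - q)) ^ 2)⁻¹ ≤ 4 * (q ^ 2)⁻¹ := by
  have h1 : 1 - q ≤ √(1 - q) := Real.le_sqrt_of_sq_le (by nlinarith)
  have h2 : √(1 - q) ≤ 1 - q / 2 := Real.sqrt_le_iff.2 ⟨by linarith, by nlinarith⟩
  constructor
  · exact inv_anti₀ (pow_pos (by linarith) 2) (pow_le_pow_left₀ (by linarith) (by linarith) 2)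
  · have : 4 * (q ^ 2)⁻¹ = ((q / 2) ^ 2)⁻¹ := by field_simp; norm_num
    rw [this]
    exact inv_anti₀ (by positivity) (pow_le_pow_left₀ (by linarith) (by linarith) 2)

variable {n : ℕ} (G : SimpleGraph (Fin n)) [DecidableRel G.Adj]

/-- The cancellation of `γ` that makes the threshold of order `1 / n²` uniformly in `γ`. -/
theorem gamma_mul_inv_sq_step_ratio (hn : 1 ≤ n) {γ : ℝ} (hγ : 0 < γ) :
    γ * ((√γ / (5 * n)) ^ 2)⁻¹ = 25 * (n : ℝ) ^ 2 := by
  have : (0 : ℝ) < n := by exact_mod_cast hn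
  rw [div_pow, Real.sq_sqrt hγ.le]
  field_simp
  norm_num

theorem le_threshold (hn : 1 ≤ n) {γ : ℝ} (hγ : 0 < γ) (hγ' : γ ≤ 1 / 2) :
    1 / 1000000 / ((1 + γ) * (n : ℝ) ^ 2) ≤ threshold (metropolis G) γ 100 := by
  have hn' : (1 : ℝ) ≤ n := by exact_mod_cast hn
  have hβ := specNorm_metropolis_sub_one_le G
  have hβ0 : 0 ≤ specNorm (metropolis G - 1) := norm_nonneg _
  obtain ⟨hκ, hκ'⟩ := kappa2_mem hn hγ'
  obtain ⟨hκ3, hκ3'⟩ := kappa3_mem hn hγ'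
  have hq : 0 < √γ / (5 * n) := by positivity
  have hq' := step_ratio_le hn hγ'
  have hγq := gamma_mul_inv_sq_step_ratio hn hγ
  rw [threshold, rate]
  set q := √γ / (5 * n)
  obtain ⟨hs, hs'⟩ := inv_sqrt_rate_mem hq.le hq'
  obtain ⟨hr, hr'⟩ := inv_rate_mem hq.le hq'
  obtain ⟨hT, hT'⟩ := inv_sq_one_sub_sqrt_mem hq hq'
  set β := specNorm (metropolis G - 1)
  set T := ((1 - √(1 - q)) ^ 2)⁻¹
  have hT0 : 0 < T := lt_of_lt_of_le (by positivity) hT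
  have hβκ : β * kappa2 n γ ≤ 6 := by nlinarith
  have hβκ0 : 0 ≤ β * kappa2 n γ := by positivity
  have h1 : γ * β * kappa2 n γ ≤ 3 := by nlinarith
  have h2 : γ * T ≤ 100 * (n : ℝ) ^ 2 := by nlinarith
  have h3 : γ * β * kappa2 n γ * 100 * (1 - q)⁻¹ * T ≤ 75000 * (n : ℝ) ^ 2 := by
    calc _ = 100 * ((β * kappa2 n γ) * (1 - q)⁻¹ * (γ * T)) := by ring
      _ ≤ 100 * (6 * (5 / 4) * (100 * (n : ℝ) ^ 2)) := by gcongr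
      _ = _ := by ring
  have h4 : 0 ≤ γ * β * kappa2 n γ * 100 * (1 - q)⁻¹ * T := by positivity
  have hn2 : 1 ≤ (n : ℝ) ^ 2 := one_le_pow₀ hn'
  have h0 : 0 ≤ γ * β * kappa2 n γ := by positivity
  rw [div_div, one_div]
  refine inv_anti₀ ?_ ?_
  · exact mul_pos (by linarith) (by linarith)
  · calc _ ≤ (2 * (2 + 3)) * (5 / 4 + 75000 * (n : ℝ) ^ 2) := by gcongr
      _ ≤ _ := by nlinarith

/-- The constant `100` enters here: `2 · 100 · (1/2) · 25 = 5000 / 2`. The case `n = 1` is excluded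
because there `W = I` and `β = 0`. -/
theorem threshold_le (hG : G.Connected) (hn : 2 ≤ n) {γ : ℝ} (hγ : 0 < γ) (hγ' : γ ≤ 1 / 2) :
    threshold (metropolis G) γ 100 ≤ (2500 * (n : ℝ) ^ 2)⁻¹ := by
  have hn1 : 1 ≤ n := by omega
  have hβ := half_le_specNorm_metropolis_sub_one G hG hn
  obtain ⟨hκ, -⟩ := kappa2_mem hn1 hγ'
  obtain ⟨hκ3, -⟩ := kappa3_mem hn1 hγ'
  have hq : 0 < √γ / (5 * n) := by positivity
  have hq' := step_ratio_le hn1 hγ'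
  have hγq := gamma_mul_inv_sq_step_ratio hn1 hγ
  rw [threshold, rate]
  set q := √γ / (5 * n)
  obtain ⟨hs, -⟩ := inv_sqrt_rate_mem hq.le hq'
  obtain ⟨hr, -⟩ := inv_rate_mem hq.le hq'
  obtain ⟨hT, -⟩ := inv_sq_one_sub_sqrt_mem hq hq'
  set β := specNorm (metropolis G - 1)
  set T := ((1 - √(1 - q)) ^ 2)⁻¹
  have hT0 : 0 < T := lt_of_lt_of_le (by positivity) hT
  have h2 : 25 * (n : ℝ) ^ 2 ≤ γ * T := by nlinarith
  have h3 : 1250 * (n : ℝ) ^ 2 ≤ γ * β * kappa2 n γ * 100 * (1 - q)⁻¹ * T := by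
    calc 1250 * (n : ℝ) ^ 2 = 100 * (1 / 2 * 1 * 1 * (25 * (n : ℝ) ^ 2)) := by ring
      _ ≤ 100 * (β * kappa2 n γ * (1 - q)⁻¹ * (γ * T)) := by gcongr
      _ = _ := by ring
  have h0 : 0 ≤ γ * β * kappa2 n γ := by positivity
  refine inv_anti₀ (by positivity) ?_
  calc 2500 * (n : ℝ) ^ 2 = 2 * 1 * (0 + 1250 * (n : ℝ) ^ 2) := by ring
    _ ≤ _ := by gcongr <;> linarith

theorem threshold_le_one (hn : 1 ≤ n) {γ : ℝ} (hγ : 0 < γ) (hγ' : γ ≤ 1 / 2) :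
    threshold (metropolis G) γ 100 ≤ 1 := by
  obtain ⟨hκ, -⟩ := kappa2_mem hn hγ'
  obtain ⟨hκ3, -⟩ := kappa3_mem hn hγ'
  have hβ : 0 ≤ specNorm (metropolis G - 1) := norm_nonneg _
  have hq : 0 < √γ / (5 * n) := by positivity
  have hq' := step_ratio_le hn hγ'
  rw [threshold, rate]
  obtain ⟨hs, -⟩ := inv_sqrt_rate_mem hq.le hq'
  obtain ⟨hr, -⟩ := inv_rate_mem hq.le hq'
  have h0 : 0 ≤ γ * specNorm (metropolis G - 1) * kappa2 n γ := by positivity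
  refine inv_le_one_of_one_le₀ ?_
  refine one_le_mul_of_one_le_of_one_le (by linarith) (le_add_of_le_of_nonneg hs ?_)
  positivity

theorem threshold_le_div (hG : G.Connected) (hn : 1 ≤ n) {γ : ℝ} (hγ : 0 < γ) (hγ' : γ ≤ 1 / 2) :
    threshold (metropolis G) γ 100 ≤ 2 / ((1 + γ) * (n : ℝ) ^ 2) := by
  rcases hn.eq_or_lt with h | h
  · refine (threshold_le_one G hn hγ hγ').trans ?_
    rw [← h, le_div_iff₀ (by positivity)]
    norm_num
    linarith
  · refine (threshold_le G hG h hγ hγ').trans ?_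
    have hn' : (0 : ℝ) < n := by exact_mod_cast hn
    rw [inv_eq_one_div, div_le_div_iff₀ (by positivity) (by positivity)]
    nlinarith [sq_nonneg (n : ℝ)]

end Parameters

/-! ### The closed loop of scalar inequalities -/

section Recursion

theorem ofReal_mul_add_le {u v : ENNReal} {a b x y : ℝ} (ha : 0 ≤ a) (hb : 0 ≤ b) (hx : 0 ≤ x)
    (hy : 0 ≤ y) (hu : u ≤ ENNReal.ofReal x) (hv : v ≤ ENNReal.ofReal y) :
    ENNReal.ofReal a * u + ENNReal.ofReal b * v ≤ ENNReal.ofReal (a * x + b * y) := by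
  rw [ENNReal.ofReal_add (by positivity) (by positivity), ENNReal.ofReal_mul ha,
    ENNReal.ofReal_mul hb]
  gcongr

/-- The closed loop of the potential `A`, the distances to consensus `B` of `X` and `H` of `Y`, the
residual `D` and the distortion `N` decays at the rate `1 - q / 2`. -/
theorem closed_loop_le {A B H D N : ℕ → ENNReal} {F q g ω : ℝ} (hF : 0 ≤ F)
    (hq' : q ≤ 1 / 5) (hg : 0 ≤ g) (hω : 0 ≤ ω) (hω' : 32 * ω ≤ 1) (hgω : g * (32 * ω) ≤ 4 / 5 * q)
    (hA0 : A 0 ≤ ENNReal.ofReal F) (hB0 : B 0 ≤ ENNReal.ofReal F) (hD0 : D 0 ≤ ENNReal.ofReal F)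
    (hA : ∀ t, A (t + 1) ≤ ENNReal.ofReal (1 - 9 / 10 * q) * A t + ENNReal.ofReal g * N t)
    (hH : ∀ t, H t ≤ ENNReal.ofReal 2 * A t)
    (hB : ∀ t, B (t + 1) ≤ ENNReal.ofReal 2 * H (t + 1) + ENNReal.ofReal 1 * H t)
    (hD : ∀ t, D (t + 1) ≤ B (t + 1) + (B t + N t))
    (hN : ∀ t, N t ≤ ENNReal.ofReal ω * D t) (t : ℕ) :
    A t ≤ ENNReal.ofReal (2 * F * (1 - q / 2) ^ t) ∧
      B t ≤ ENNReal.ofReal (13 * F * (1 - q / 2) ^ t) ∧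
      D t ≤ ENNReal.ofReal (32 * F * (1 - q / 2) ^ t) := by
  have hρ : 9 / 10 ≤ 1 - q / 2 := by linarith
  induction t with
  | zero =>
    refine ⟨hA0.trans ?_, hB0.trans ?_, hD0.trans ?_⟩ <;>
      exact ENNReal.ofReal_le_ofReal (by simp; linarith)
  | succ t ih =>
    obtain ⟨ihA, ihB, ihD⟩ := ih
    have hHle : ∀ s, A s ≤ ENNReal.ofReal (2 * F * (1 - q / 2) ^ s) →
        H s ≤ ENNReal.ofReal (4 * F * (1 - q / 2) ^ s) := by
      intro s hs
      refine (hH s).trans ((mul_le_mul_right hs _).trans_eq ?_)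
      rw [← ENNReal.ofReal_mul (by norm_num)]
      ring_nf
    rw [pow_succ]
    set p := F * (1 - q / 2) ^ t with hp
    have hp0 : 0 ≤ p := mul_nonneg hF (pow_nonneg (by linarith) _)
    have hNt : N t ≤ ENNReal.ofReal (32 * ω * p) := by
      refine (hN t).trans ((mul_le_mul_right ihD _).trans_eq ?_)
      rw [← ENNReal.ofReal_mul hω]
      congr 1
      rw [hp]; ring
    have hA1 : A (t + 1) ≤ ENNReal.ofReal (2 * F * ((1 - q / 2) ^ t * (1 - q / 2))) := by
      refine (hA t).trans ((ofReal_mul_add_le (by linarith) hg ?_ (by positivity) ihA hNt).trans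
        (ENNReal.ofReal_le_ofReal ?_))
      · rw [mul_assoc, ← hp]; positivity
      -- The contraction leaves `2 - 9q/5` and the distortion adds at most `4q/5`, which is exactly
      -- `2 (1 - q / 2)`.
      · have := mul_le_mul_of_nonneg_right hgω hp0
        have e1 : 2 * F * (1 - q / 2) ^ t = 2 * p := by rw [hp]; ring
        have e2 : 2 * F * ((1 - q / 2) ^ t * (1 - q / 2)) = 2 * p * (1 - q / 2) := by rw [hp]; ring
        rw [e1, e2]
        linarith
    have hB1 : B (t + 1) ≤ ENNReal.ofReal (13 * F * ((1 - q / 2) ^ t * (1 - q / 2))) := by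
      have e1 : 4 * F * (1 - q / 2) ^ t = 4 * p := by rw [hp]; ring
      have e2 : 4 * F * (1 - q / 2) ^ (t + 1) = 4 * p * (1 - q / 2) := by rw [hp, pow_succ]; ring
      have e3 : 13 * F * ((1 - q / 2) ^ t * (1 - q / 2)) = 13 * p * (1 - q / 2) := by rw [hp]; ring
      have h1 := hHle (t + 1) (by rwa [pow_succ])
      have h2 := hHle t ihA
      rw [e2] at h1
      rw [e1] at h2
      refine (hB t).trans ((ofReal_mul_add_le (by norm_num) (by norm_num)
        (mul_nonneg (by positivity) (by linarith)) (by positivity) h1 h2).trans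
        (ENNReal.ofReal_le_ofReal ?_))
      rw [e3]
      -- The constant `13` fits as `8 (1 - q/2) + 4 ≤ 13 (1 - q/2)`; below, `32` fits as `13 (1 -
      -- q/2) + 13 + 1 ≤ 32 (1 - q/2)`.
      nlinarith
    refine ⟨hA1, hB1, ?_⟩
    have e1 : 13 * F * (1 - q / 2) ^ t = 13 * p := by rw [hp]; ring
    have e2 : 13 * F * ((1 - q / 2) ^ t * (1 - q / 2)) = 13 * p * (1 - q / 2) := by rw [hp]; ring
    have e3 : 32 * F * ((1 - q / 2) ^ t * (1 - q / 2)) = 32 * p * (1 - q / 2) := by rw [hp]; ring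
    rw [e1] at ihB
    rw [e2] at hB1
    refine (hD t).trans ((add_le_add hB1 (add_le_add ihB hNt)).trans ?_)
    rw [← ENNReal.ofReal_add (by positivity) (by positivity),
      ← ENNReal.ofReal_add (mul_nonneg (by positivity) (by linarith)) (by positivity), e3]
    refine ENNReal.ofReal_le_ofReal ?_
    nlinarith

end Recursion

/-! ### The run as a perturbed linear recursion -/

section Dynamics

variable {n d : ℕ} {Z : Type*} (G : SimpleGraph (Fin n)) [DecidableRel G.Adj]

theorem act_metropolis_sub_one_avg (X : Rows n d) : act (metropolis G - 1) (avg X) = 0 := by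
  funext i
  simp only [act, avg]
  rw [← Finset.sum_smul, sum_metropolis_sub_one, zero_smul]
  rfl

theorem sum_act_metropolis_sub_one (X : Rows n d) : ∑ i, act (metropolis G - 1) X i = 0 := by
  simp only [act]
  rw [Finset.sum_comm]
  refine Finset.sum_eq_zero fun j _ => ?_
  rw [← Finset.sum_smul, Finset.sum_congr rfl fun i _ => ?_, sum_metropolis_sub_one G j, zero_smul]
  exact congrFun (congrFun ((metropolis_isSymm G).sub Matrix.isSymm_one) j) i

theorem sum_sub_avg (X : Rows n d) : ∑ i, (X - avg X) i = 0 := by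
  rcases Nat.eq_zero_or_pos n with rfl | hn
  · simp
  · have : (n : ℝ) ≠ 0 := by positivity
    simp only [Pi.sub_apply, avg, Finset.sum_sub_distrib, Finset.sum_const, Finset.card_univ,
      Fintype.card_fin]
    rw [← Nat.cast_smul_eq_nsmul ℝ, smul_smul, mul_inv_cancel₀ this, one_smul, sub_self]

theorem frob_sub_avg_le (X : Rows n d) : frob (X - avg X) ≤ frob X := by
  have h : ∑ i, inner ℝ (X i - avg X i) (avg X i) = 0 := by
    have := sum_sub_avg X
    simp only [avg, Pi.sub_apply] at this ⊢
    rw [← sum_inner, this, inner_zero_left]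
  rw [← sq_le_sq₀ (frob_nonneg _) (frob_nonneg _), frob_sq, frob_sq]
  have h2 : ∀ i, ‖X i‖ ^ 2 = ‖(X - avg X) i‖ ^ 2 + 2 * inner ℝ (X i - avg X i) (avg X i) +
      ‖avg X i‖ ^ 2 := by
    intro i
    rw [Pi.sub_apply, ← norm_add_sq_real, sub_add_cancel]
  simp_rw [h2]
  rw [Finset.sum_add_distrib, Finset.sum_add_distrib, ← Finset.mul_sum, h, mul_zero, add_zero]
  exact le_add_of_nonneg_right (Finset.sum_nonneg fun _ _ => sq_nonneg _)

variable (γ σ : ℝ) (Q : Vec d → Z → Vec d) (X₀ : Rows n d) (z : ℕ → Fin n → Z) (t : ℕ)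

/-- The new `X̂` is `X` plus the distortion, and `W - I` annihilates the average. -/
theorem run_succ_y_sub_avg :
    (run (metropolis G) γ σ Q X₀ z (t + 1)).y - avg X₀ =
      ((run (metropolis G) γ σ Q X₀ z t).x - avg X₀) + γ • act (metropolis G - 1)
        (((run (metropolis G) γ σ Q X₀ z t).x - avg X₀) +
          distortion Q (residual (metropolis G) γ σ Q X₀ z t) (z t)) := by
  set S := run (metropolis G) γ σ Q X₀ z t with hS
  have h1 : (S.x - avg X₀) + distortion Q (residual (metropolis G) γ σ Q X₀ z t) (z t) =
      (run (metropolis G) γ σ Q X₀ z (t + 1)).xhat - avg X₀ := by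
    funext i
    simp only [run, step, distortion, residual, ← hS, Pi.add_apply, Pi.sub_apply]
    abel
  have h2 : (run (metropolis G) γ σ Q X₀ z (t + 1)).y =
      S.x + γ • act (metropolis G - 1) (run (metropolis G) γ σ Q X₀ z (t + 1)).xhat := rfl
  rw [h1, act_sub, act_metropolis_sub_one_avg, sub_zero, h2]
  abel

theorem run_succ_x_sub_avg (W : Matrix (Fin n) (Fin n) ℝ) :
    (run W γ σ Q X₀ z (t + 1)).x - avg X₀ =
      (1 + σ) • ((run W γ σ Q X₀ z (t + 1)).y - avg X₀) - σ • ((run W γ σ Q X₀ z t).y - avg X₀) := by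
  have : (run W γ σ Q X₀ z (t + 1)).x =
    (1 + σ) • (run W γ σ Q X₀ z (t + 1)).y - σ • (run W γ σ Q X₀ z t).y := rfl
  rw [this]
  module

theorem residual_succ (W : Matrix (Fin n) (Fin n) ℝ) :
    residual W γ σ Q X₀ z (t + 1) = ((run W γ σ Q X₀ z (t + 1)).x - avg X₀) -
      (((run W γ σ Q X₀ z t).x - avg X₀) + distortion Q (residual W γ σ Q X₀ z t) (z t)) := by
  have : (run W γ σ Q X₀ z (t + 1)).xhat =
      (run W γ σ Q X₀ z t).x + distortion Q (residual W γ σ Q X₀ z t) (z t) := by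
    funext i
    simp only [run, step, distortion, residual, Pi.add_apply, Pi.sub_apply]
    abel
  rw [residual, this]
  abel

theorem sum_run_sub_avg : ∑ i, ((run (metropolis G) γ σ Q X₀ z t).y - avg X₀) i = 0 ∧
    ∑ i, ((run (metropolis G) γ σ Q X₀ z t).x - avg X₀) i = 0 := by
  induction t with
  | zero => exact ⟨sum_sub_avg X₀, sum_sub_avg X₀⟩
  | succ t ih =>
    have hy : ∑ i, ((run (metropolis G) γ σ Q X₀ z (t + 1)).y - avg X₀) i = 0 := by
      rw [run_succ_y_sub_avg]
      simp only [Pi.add_apply (M := fun _ => Vec d), Pi.smul_apply, Finset.sum_add_distrib,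
        ← Finset.smul_sum, sum_act_metropolis_sub_one, ih.2, smul_zero, add_zero]
    refine ⟨hy, ?_⟩
    rw [run_succ_x_sub_avg]
    have h1 := ih.1
    simp only [Pi.sub_apply, Pi.smul_apply] at hy h1 ⊢
    rw [Finset.sum_sub_distrib, ← Finset.smul_sum, ← Finset.smul_sum, hy, h1, smul_zero, smul_zero,
      sub_zero]

end Dynamics

/-! ### Convergence in mean -/

section Convergence

variable {n d : ℕ} {Z : Type*} (G : SimpleGraph (Fin n)) [DecidableRel G.Adj]

theorem run_of_metropolis_eq_one (hW : metropolis G = 1) (γ σ : ℝ) (Q : Vec d → Z → Vec d)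
    (X₀ : Rows n d) (z : ℕ → Fin n → Z) (t : ℕ) :
    (run (metropolis G) γ σ Q X₀ z t).y = X₀ ∧ (run (metropolis G) γ σ Q X₀ z t).x = X₀ := by
  induction t with
  | zero => exact ⟨rfl, rfl⟩
  | succ t ih =>
    have hy : (run (metropolis G) γ σ Q X₀ z (t + 1)).y = X₀ := by
      have : (run (metropolis G) γ σ Q X₀ z (t + 1)).y = (run (metropolis G) γ σ Q X₀ z t).x +
        γ • act (metropolis G - 1) (run (metropolis G) γ σ Q X₀ z (t + 1)).xhat := rfl
      rw [this, ih.2, hW, sub_self]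
      funext i
      simp [act]
    refine ⟨hy, ?_⟩
    have : (run (metropolis G) γ σ Q X₀ z (t + 1)).x =
      (1 + σ) • (run (metropolis G) γ σ Q X₀ z (t + 1)).y -
        σ • (run (metropolis G) γ σ Q X₀ z t).y := rfl
    rw [this, hy, ih.1]
    module

theorem err_fin_one (G : SimpleGraph (Fin 1)) [DecidableRel G.Adj] (γ : ℝ) (Q : Vec d → Z → Vec d)
    (X₀ : Rows 1 d) (z : ℕ → Fin 1 → Z) (t : ℕ) : err G γ Q X₀ z t = 0 := by
  have hW : metropolis G = 1 := by
    ext i j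
    fin_cases i; fin_cases j
    simp [metropolis]
  rw [err, (run_of_metropolis_eq_one G hW _ _ _ _ _ _).2]
  simp [frob, avg]

variable [MeasurableSpace Z]

theorem measurable_err (γ : ℝ) {Q : Vec d → Z → Vec d}
    (hQ : Measurable fun p : Vec d × Z => Q p.1 p.2) (X₀ : Rows n d) (t : ℕ) :
    Measurable fun z => err G γ Q X₀ z t :=
  measurable_frob.comp ((measurable_run _ _ _ hQ X₀ t).2.2.sub measurable_const)

theorem lintegral_err_le (hG : G.Connected) (hn : 2 ≤ n) {γ : ℝ} (hγ : 0 < γ) (hγ' : γ ≤ 1 / 2)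
    {ω : ℝ} (hω : 0 ≤ ω) (hω' : ω ≤ (2500 * (n : ℝ) ^ 2)⁻¹)
    {P : Measure Z} [IsProbabilityMeasure P] {Q : Vec d → Z → Vec d} (hQ : IsCompressor P ω Q)
    {Ω : Type*} [MeasurableSpace Ω] (μ : Measure Ω) [IsProbabilityMeasure μ]
    {ζ : ℕ → Fin n → Ω → Z} (hζ : ∀ t i, Measurable (ζ t i))
    (hlaw : ∀ t i, Measure.map (ζ t i) μ = P)
    (hind : iIndepFun (fun (t : ℕ) (w : Ω) (i : Fin n) => ζ t i w) μ) (X₀ : Rows n d) (t : ℕ) :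
    ∫⁻ w, ENNReal.ofReal (err G γ Q X₀ (fun s i => ζ s i w) t) ∂μ ≤
      ENNReal.ofReal (13 * frob X₀ * rateTilde n γ ^ t) := by
  have hn1 : 1 ≤ n := by omega
  have hn2 : (2 : ℝ) ≤ n := by exact_mod_cast hn
  have hq0 : 0 < √γ / (5 * n) := by positivity
  have hq5 := step_ratio_le hn1 hγ'
  have hσ := momentum_eq hn1 γ
  obtain ⟨hσ0, hσ1⟩ := momentum_mem hn1 hγ'
  have hγq := gamma_mul_inv_sq_step_ratio hn1 hγ
  have hrate : rateTilde n γ = 1 - √γ / (5 * n) / 2 := by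
    rw [rateTilde]
    field_simp
    ring
  have hsqrt : √γ = √γ / (5 * n) * (5 * n) := by field_simp
  rw [hrate]
  set q := √γ / (5 * n)
  have hωn : 2500 * (n : ℝ) ^ 2 * ω ≤ 1 := by
    rwa [← le_inv_mul_iff₀ (by positivity), mul_one]
  obtain ⟨U, ν, hU, hUB, hν⟩ := exists_modes G hG
  set δ : Fin n → ℝ := fun k => γ * ν k with hδ
  have hq2 : γ = 25 * (n : ℝ) ^ 2 * q ^ 2 := by
    rw [← hγq]
    field_simp
  have hgap : IsGapped δ q := by
    intro k
    rcases hν k with ⟨h, -⟩ | ⟨h, h'⟩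
    · left; simp [hδ, h]
    · right
      have h1 : 2 * q ^ 2 ≤ γ * ν k := by
        -- The `5` in `q` is used here: the spectral gap gives `δ ≥ (25/12) q²`, just above the
        -- required `2 q²`.
        have : γ * ν k = 25 / 12 * q ^ 2 * (12 * n ^ 2 * ν k) := by
          rw [hq2]; ring
        rw [this]
        nlinarith [sq_nonneg q]
      exact ⟨lt_of_lt_of_le (by positivity) h1, h1, by nlinarith⟩
  have hconst : ∀ k, δ k = 0 → ∀ i j, U i k = U j k := by
    intro k hk
    rcases hν k with ⟨-, h⟩ | ⟨h, -⟩
    · exact h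
    · rcases mul_eq_zero.1 hk with h0 | h0
      · exact absurd h0 hγ.ne'
      · rw [h0] at h
        norm_num at h
  have hν2 : ∀ k, ν k ≤ 2 := by
    intro k
    rcases hν k with ⟨h, -⟩ | ⟨-, h⟩
    · rw [h]; norm_num
    · exact h
  have hζm : Measurable fun w => fun (s : ℕ) (i : Fin n) => ζ s i w :=
    measurable_pi_lambda _ fun s => measurable_pi_lambda _ (hζ s)
  set W := metropolis G
  set σ := momentum n γ
  set S : Ω → ℕ → State n d := fun w => run W γ σ Q X₀ (fun s i => ζ s i w) with hS
  set R : Ω → ℕ → Rows n d := fun w => residual W γ σ Q X₀ (fun s i => ζ s i w) with hR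
  set N : Ω → ℕ → Rows n d := fun w t => distortion Q (R w t) (fun i => ζ t i w) with hN
  have hmx : ∀ t, Measurable fun w => ENNReal.ofReal (frob ((S w t).x - avg X₀)) := fun t =>
    (measurable_frob.comp (((measurable_run W γ σ hQ.measurable X₀ t).2.2.comp hζm).sub
      measurable_const)).ennreal_ofReal
  have hmy : ∀ t, Measurable fun w => ENNReal.ofReal (frob ((S w t).y - avg X₀)) := fun t =>
    (measurable_frob.comp (((measurable_run W γ σ hQ.measurable X₀ t).2.1.comp hζm).sub
      measurable_const)).ennreal_ofReal
  have hmN : ∀ t, Measurable fun w => ENNReal.ofReal (frob (N w t)) := fun t =>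
    (measurable_frob.comp ((measurable_distortion hQ.measurable).comp
      (((measurable_residual W γ σ hQ.measurable X₀ t).comp hζm).prodMk
        (measurable_pi_lambda _ (hζ t))))).ennreal_ofReal
  have hX0 := frob_sub_avg_le X₀
  refine (closed_loop_le
    (A := fun t => ∫⁻ w, ENNReal.ofReal
      ‖potential U δ q ((S w t).x - avg X₀) ((S w t).y - avg X₀)‖ ∂μ)
    (B := fun t => ∫⁻ w, ENNReal.ofReal (frob ((S w t).x - avg X₀)) ∂μ)
    (H := fun t => ∫⁻ w, ENNReal.ofReal (frob ((S w t).y - avg X₀)) ∂μ)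
    (D := fun t => ∫⁻ w, ENNReal.ofReal (frob (R w t)) ∂μ)
    (N := fun t => ∫⁻ w, ENNReal.ofReal (frob (N w t)) ∂μ)
    (F := frob X₀) (q := q) (g := 2 * √γ) (ω := ω) (frob_nonneg _) hq5 (by positivity) hω ?_ ?_
    ?_ ?_ ?_ ?_ ?_ ?_ ?_ ?_ t).2.1
  · nlinarith
  · rw [hsqrt]
    -- With `√γ = 5 n q`, the loop condition `2 √γ · 32 ω ≤ 4q/5` reads `400 n ω ≤ 1`.
    have : 400 * n * ω ≤ 1 := by nlinarith
    nlinarith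
  · refine (lintegral_mono fun w => ENNReal.ofReal_le_ofReal
      ((norm_potential_diag_le hU hgap hq0.le (X₀ - avg X₀)).trans hX0)).trans_eq ?_
    simp
  · refine (lintegral_mono fun w => ENNReal.ofReal_le_ofReal hX0).trans_eq ?_
    simp
  · refine (lintegral_mono fun w => ENNReal.ofReal_le_ofReal (q := frob X₀) (le_of_eq ?_)).trans_eq ?_
    · simp [hR, residual, run]
    · simp
  · intro t
    rw [← lintegral_const_mul' _ _ ENNReal.ofReal_ne_top,
      ← lintegral_const_mul _ (hmN t), ← lintegral_add_right _ ((hmN t).const_mul _)]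
    refine lintegral_mono fun w => ?_
    rw [← ENNReal.ofReal_mul (by linarith), ← ENNReal.ofReal_mul (by positivity),
      ← ENNReal.ofReal_add (mul_nonneg (by linarith) (norm_nonneg _))
        (mul_nonneg (by positivity) (frob_nonneg _))]
    refine ENNReal.ofReal_le_ofReal ?_
    have h := norm_potential_step_le hU hγ.le hq0.le hq5 hν2 hUB (fun _ => rfl) hgap
      ((S w t).x - avg X₀) ((S w t).y - avg X₀) (N w t)
    rw [← hσ, ← run_succ_y_sub_avg G γ σ Q X₀ (fun s i => ζ s i w) t, ← run_succ_x_sub_avg] at h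
    exact h
  · intro t
    rw [← lintegral_const_mul' _ _ ENNReal.ofReal_ne_top]
    refine lintegral_mono fun w => ?_
    rw [← ENNReal.ofReal_mul (by norm_num)]
    exact ENNReal.ofReal_le_ofReal (frob_le_norm_potential hU hgap hconst hq0.le hq5 _ _
      (sum_run_sub_avg G γ σ Q X₀ _ t).1)
  · intro t
    rw [← lintegral_const_mul _ (hmy _), ← lintegral_const_mul _ (hmy _),
      ← lintegral_add_right _ ((hmy t).const_mul _)]
    refine lintegral_mono fun w => ?_
    rw [← ENNReal.ofReal_mul (by norm_num), ← ENNReal.ofReal_mul (by norm_num),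
      ← ENNReal.ofReal_add (mul_nonneg (by norm_num) (frob_nonneg _))
        (mul_nonneg (by norm_num) (frob_nonneg _))]
    refine ENNReal.ofReal_le_ofReal ?_
    have hx := run_succ_x_sub_avg γ σ Q X₀ (fun s i => ζ s i w) t W
    simp only [hS]
    rw [hx]
    refine (frob_sub_le _ _).trans ?_
    rw [frob_smul, frob_smul, abs_of_nonneg (by linarith), abs_of_nonneg hσ0]
    exact add_le_add (mul_le_mul_of_nonneg_right (by linarith) (frob_nonneg _))
      (mul_le_mul_of_nonneg_right hσ1 (frob_nonneg _))
  · intro t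
    rw [← lintegral_add_right _ (hmN t), ← lintegral_add_left (hmx _)]
    refine lintegral_mono fun w => ?_
    rw [← ENNReal.ofReal_add (frob_nonneg _) (frob_nonneg _),
      ← ENNReal.ofReal_add (frob_nonneg _) (add_nonneg (frob_nonneg _) (frob_nonneg _))]
    refine ENNReal.ofReal_le_ofReal ?_
    have hr := residual_succ γ σ Q X₀ (fun s i => ζ s i w) t W
    simp only [hR]
    rw [hr]
    exact (frob_sub_le _ _).trans (add_le_add le_rfl (frob_add_le _ _))
  · intro t
    exact lintegral_frob_distortion_residual_le hω hQ μ hζ hlaw hind W γ σ X₀ t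

theorem integrable_err_and_integral_le (hG : G.Connected) {γ : ℝ} (hγ : 0 < γ) (hγ' : γ ≤ 1 / 2)
    {ω : ℝ} (hω : 0 ≤ ω) (hω' : ω ≤ threshold (metropolis G) γ 100)
    {P : Measure Z} [IsProbabilityMeasure P] {Q : Vec d → Z → Vec d} (hQ : IsCompressor P ω Q)
    {Ω : Type*} [MeasurableSpace Ω] (μ : Measure Ω) [IsProbabilityMeasure μ]
    {ζ : ℕ → Fin n → Ω → Z} (hζ : ∀ t i, Measurable (ζ t i))
    (hlaw : ∀ t i, Measure.map (ζ t i) μ = P)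
    (hind : iIndepFun (fun (t : ℕ) (w : Ω) (i : Fin n) => ζ t i w) μ) (X₀ : Rows n d) (t : ℕ) :
    Integrable (fun w => err G γ Q X₀ (fun s i => ζ s i w) t) μ ∧
      ∫ w, err G γ Q X₀ (fun s i => ζ s i w) t ∂μ ≤ 13 * rateTilde n γ ^ t * frob X₀ := by
  have hn : 1 ≤ n := by
    obtain ⟨i⟩ := hG.nonempty
    exact i.pos
  have hrate : 0 ≤ rateTilde n γ := by
    have h := step_ratio_le hn hγ'
    have h0 : 0 ≤ √γ / (5 * n) := by positivity
    have : √γ / (10 * n) = √γ / (5 * n) / 2 := by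
      have : (n : ℝ) ≠ 0 := by positivity
      field_simp
      norm_num
    rw [rateTilde, this]
    linarith
  have hle : ∫⁻ w, ENNReal.ofReal (err G γ Q X₀ (fun s i => ζ s i w) t) ∂μ ≤
      ENNReal.ofReal (13 * frob X₀ * rateTilde n γ ^ t) := by
    rcases hn.eq_or_lt with rfl | h
    · simp [err_fin_one]
    · exact lintegral_err_le G hG h hγ hγ' hω (hω'.trans (threshold_le G hG h hγ hγ')) hQ μ hζ hlaw
        hind X₀ t
  have hm : Measurable fun w => err G γ Q X₀ (fun s i => ζ s i w) t :=
    (measurable_err G γ hQ.measurable X₀ t).comp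
      (measurable_pi_lambda _ fun s => measurable_pi_lambda _ (hζ s))
  have hnonneg : ∀ w, 0 ≤ err G γ Q X₀ (fun s i => ζ s i w) t := fun w => frob_nonneg _
  constructor
  · refine ⟨hm.aestronglyMeasurable, ?_⟩
    rw [hasFiniteIntegral_iff_ofReal (Filter.Eventually.of_forall hnonneg)]
    exact hle.trans_lt ENNReal.ofReal_lt_top
  · rw [integral_eq_lintegral_of_nonneg_ae (Filter.Eventually.of_forall hnonneg)
      hm.aestronglyMeasurable]
    refine ENNReal.toReal_le_of_le_ofReal
      (mul_nonneg (mul_nonneg (by norm_num) (pow_nonneg hrate t)) (frob_nonneg _))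
      (hle.trans_eq ?_)
    congr 1
    ring

end Convergence

end SCG

/-- `C`, `K`, `c₁`, `c₂` are absolute constants; `C₀` depends on `X₀` alone. The randomness is
fresh in every round; within a round the agents' randomness may be dependent. -/
theorem theorem2 :
    ∃ C > (0 : ℝ), ∃ K > (0 : ℝ), ∃ c₁ > (0 : ℝ), ∃ c₂ > (0 : ℝ),
    ∀ (n d : ℕ) (X₀ : SCG.Rows n d), ∃ C₀ > (0 : ℝ),
    ∀ (G : SimpleGraph (Fin n)) [DecidableRel G.Adj], G.Connected →
    ∀ γ : ℝ, 0 < γ → γ ≤ 1 / 2 →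
      (c₁ / ((1 + γ) * (n : ℝ) ^ 2) ≤ SCG.threshold (SCG.metropolis G) γ C ∧
        SCG.threshold (SCG.metropolis G) γ C ≤ c₂ / ((1 + γ) * (n : ℝ) ^ 2)) ∧
      ∀ ω : ℝ, 0 ≤ ω → ω < 1 → ω ≤ SCG.threshold (SCG.metropolis G) γ C →
      ∀ (Z : Type*) [MeasurableSpace Z] (P : Measure Z) [IsProbabilityMeasure P]
        (Q : SCG.Vec d → Z → SCG.Vec d), SCG.IsCompressor P ω Q →
      ∀ (Ω : Type*) [MeasurableSpace Ω] (μ : Measure Ω) [IsProbabilityMeasure μ]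
        (ζ : ℕ → Fin n → Ω → Z),
        (∀ t i, Measurable (ζ t i)) →
        (∀ t i, Measure.map (ζ t i) μ = P) →
        iIndepFun (fun (t : ℕ) (w : Ω) (i : Fin n) => ζ t i w) μ →
      ∀ t : ℕ,
        Integrable (fun w => SCG.err G γ Q X₀ (fun s i => ζ s i w) t) μ ∧
        ∫ w, SCG.err G γ Q X₀ (fun s i => ζ s i w) t ∂μ ≤
          K * SCG.rateTilde n γ ^ t * SCG.frob X₀ ∧
        (X₀ ≠ SCG.avg X₀ →
          ∫ w, SCG.err G γ Q X₀ (fun s i => ζ s i w) t ∂μ ≤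
            C₀ * SCG.rateTilde n γ ^ t * SCG.frob (X₀ - SCG.avg X₀)) := by
  refine ⟨100, by norm_num, 13, by norm_num, 1 / 1000000, by norm_num, 2, by norm_num, ?_⟩
  intro n d X₀
  -- The summand `1` keeps the constant positive when the quotient is `0`, as it is for `X₀` at
  -- consensus.
  refine ⟨13 * SCG.frob X₀ / SCG.frob (X₀ - SCG.avg X₀) + 1,
    add_pos_of_nonneg_of_pos (div_nonneg (mul_nonneg (by norm_num) (SCG.frob_nonneg _))
      (SCG.frob_nonneg _)) one_pos, ?_⟩
  intro G _ hG γ hγ hγ'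
  have hn : 1 ≤ n := by
    obtain ⟨i⟩ := hG.nonempty
    exact i.pos
  refine ⟨⟨SCG.le_threshold G hn hγ hγ', SCG.threshold_le_div G hG hn hγ hγ'⟩, ?_⟩
  intro ω hω _ hωt Z _ P _ Q hQ Ω _ μ _ ζ hζ hlaw hind t
  obtain ⟨h1, h2⟩ :=
    SCG.integrable_err_and_integral_le G hG hγ hγ' hω hωt hQ μ hζ hlaw hind X₀ t
  refine ⟨h1, h2, fun hne => h2.trans ?_⟩
  have hpos : 0 < SCG.frob (X₀ - SCG.avg X₀) := by
    refine (SCG.frob_nonneg _).lt_of_ne' fun h => hne ?_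
    rw [SCG.frob_eq_norm, norm_eq_zero, WithLp.toLp_eq_zero] at h
    exact sub_eq_zero.1 h
  -- Nonnegativity is read off from `h2`, which bounds a nonnegative integral, since `frob X₀` is
  -- positive.
  have hrate : 0 ≤ SCG.rateTilde n γ ^ t := by
    have h0 : 0 ≤ 13 * SCG.rateTilde n γ ^ t * SCG.frob X₀ :=
      (integral_nonneg fun _ => SCG.frob_nonneg _).trans h2
    have hX : 0 < SCG.frob X₀ := hpos.trans_le (SCG.frob_sub_avg_le X₀)
    have := nonneg_of_mul_nonneg_left h0 hX
    linarith
  calc 13 * SCG.rateTilde n γ ^ t * SCG.frob X₀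
      = 13 * SCG.frob X₀ / SCG.frob (X₀ - SCG.avg X₀) * SCG.rateTilde n γ ^ t *
        SCG.frob (X₀ - SCG.avg X₀) := by
        field_simp
    _ ≤ _ := by
        gcongr
        linarith
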